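/- **Theorem (optimum query set in polynomial time).** An instance consists of $n\ge 0$ intervals $I_i=[\ell_i,r_i]$ with actual values $v_i\in I_i$, query costs $w_i\ge 0$ and an error threshold $\delta\ge 0$ (all real numbers). A set $Q\subseteq\{1,\dots,n\}$ *proves an ordering* if there is a permutation $\pi$ of $\{1,\dots,n\}$ such that, for every vector $x$ with $x_i\in I_i$ for all $i$ and $x_i=v_i$ for all $i\in Q$, one has $x_i\le x_j+\delta$ whenever $\pi(i)<\pi(j)$. An *optimum query set* is a set $Q$ that proves an ordering and minimizes $\sum_{i\in Q}w_i$ among all such sets. There is an algorithm which, given $n$, the intervals, the actual values, the costs and $\delta$, computes an optimum query set in polynomial time. Precisely: there are a single program for a random access machine with cells for natural numbers and for real numbers, whose only arithmetic operations are addition, subtraction and comparison, and two polynomials $p,q$ such that on every instance the program halts after at most $p(n)$ operations with an optimum query set as its output, and, if all numbers of the instance are rational, the total logarithmic cost of its operations (each operation being charged the binary length of the numbers involved) is at most $q(L)$, where $L$ is $n$ plus the total binary length of the numbers in the instance. Moreover, the set $Q$ computed has the following form. Let $F$ be the set of all $j$ such that $\ell_j<v_i-\delta$ and $v_i+\delta<r_j$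 for some $i\ne j$, and let $G$ be the graph on $\{1,\dots,n\}\setminus F$ in which two distinct $i,j$ are adjacent if and only if $r_i-\ell_j>\delta$ and $r_j-\ell_i>\delta$. Then $G$ is chordal and $Q=F\cup C$, where $C$ is a vertex cover of $G$ of minimum total cost. -/

import Mathlib

open Finset

/-! ### The sorting problem with uncertainty, with the actual values given -/

namespace QuerySort

/-- An instance with `n` items: the uncertainty intervals `[lo i, hi i]`, the actual values
`val i`, the query costs `cost i` and the error threshold `delta`. -/
structure Input (n : ℕ) where
  lo : Fin n → ℝ
  hi : Fin n → ℝ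
  val : Fin n → ℝ
  cost : Fin n → ℝ
  delta : ℝ
  lo_le_val : ∀ i, lo i ≤ val i
  val_le_hi : ∀ i, val i ≤ hi i
  cost_nonneg : ∀ i, 0 ≤ cost i
  delta_nonneg : 0 ≤ delta

namespace Input

variable {n : ℕ}

/-- The vector `x` of values is possible for somebody who knows the intervals and the answers to
the queries in `Q`. -/
def Consistent (I : Input n) (Q : Finset (Fin n)) (x : Fin n → ℝ) : Prop :=
  (∀ i, I.lo i ≤ x i ∧ x i ≤ I.hi i) ∧ ∀ i ∈ Q, x i = I.val i

/-- The queries in `Q` prove an ordering: some permutation is correct up to the error threshold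
for all values that are consistent with the answers. -/
def ProvesOrdering (I : Input n) (Q : Finset (Fin n)) : Prop :=
  ∃ π : Equiv.Perm (Fin n), ∀ x, I.Consistent Q x → ∀ i j, π i < π j → x i ≤ x j + I.delta

/-- `Q` is a minimum-cost set of queries that proves an ordering. -/
def IsOptimumQuerySet (I : Input n) (Q : Finset (Fin n)) : Prop :=
  I.ProvesOrdering Q ∧
    ∀ Q' : Finset (Fin n), I.ProvesOrdering Q' → ∑ i ∈ Q, I.cost i ≤ ∑ i ∈ Q', I.cost i

/-- The dependency graph of the intervals. -/
def depGraph (I : Input n) : SimpleGraph (Fin n) where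
  Adj i j := i ≠ j ∧ I.delta < I.hi i - I.lo j ∧ I.delta < I.hi j - I.lo i
  symm := ⟨fun _ _ h => ⟨h.1.symm, h.2.2, h.2.1⟩⟩
  loopless := ⟨fun _ h => h.1 rfl⟩

open Classical in
/-- The forced queries: the items `j` such that `[val i - delta, val i + delta]` lies in the
interior of the interval of `j` for some other item `i`. -/
noncomputable def forced (I : Input n) : Finset (Fin n) :=
  {j | ∃ i, i ≠ j ∧ I.lo j < I.val i - I.delta ∧ I.val i + I.delta < I.hi j}

/-- The dependency graph of the intervals that are not forced to be queried. -/
def remainingGraph (I : Input n) : SimpleGraph {i : Fin n // i ∉ I.forced} :=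
  I.depGraph.comap Subtype.val

end Input

/-- `C` is a vertex cover of `G` of minimum total weight. -/
def IsMinWeightVertexCover {V : Type*} (G : SimpleGraph V) (w : V → ℝ) (C : Finset V) : Prop :=
  G.IsVertexCover (C : Set V) ∧
    ∀ D : Finset V, G.IsVertexCover (D : Set V) → ∑ v ∈ C, w v ≤ ∑ v ∈ D, w v

/-- A graph is chordal if it has no induced cycle of length at least four. -/
def IsChordal {V : Type*} (G : SimpleGraph V) : Prop :=
  ∀ k : ℕ, 4 ≤ k → IsEmpty (SimpleGraph.cycleGraph k ↪g G)

/-! ### Random access machines over the reals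

The memory consists of arrays of natural numbers (for counters and indices) and arrays of
real numbers. An array has a fixed name, and a cell of it is addressed by a computed natural
number. The only arithmetic operations are addition, subtraction and comparison; there is no
multiplication, no rounding, no conversion between the two kinds of numbers, and no constant other
than the natural numerals. -/

/-- The memory: `nat a k` and `real a k` are the contents of cell `k` of the array with name `a`. -/
structure Memory where
  nat : ℕ → ℕ → ℕ
  real : ℕ → ℕ → ℝ

/-- `m.setNat a k v` is `m` with `v` stored in cell `k` of the array `a` of natural numbers. -/
def Memory.setNat (m : Memory) (a k v : ℕ) : Memory :=
  { m with nat := fun b l => if b = a ∧ l = k then v else m.nat b l }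

/-- `m.setReal a k v` is `m` with `v` stored in cell `k` of the array `a` of real numbers. -/
noncomputable def Memory.setReal (m : Memory) (a k : ℕ) (v : ℝ) : Memory :=
  { m with real := fun b l => if b = a ∧ l = k then v else m.real b l }

/-- The length of the numerator and the denominator in binary if `x` is rational. (The value at
irrational numbers is not meaningful and is never used.) -/
noncomputable def realBits (x : ℝ) : ℕ :=
  open Classical in
  if h : ∃ q : ℚ, (q : ℝ) = x then Nat.size h.choose.num.natAbs + Nat.size h.choose.den else 0

theorem realBits_ratCast (q : ℚ) :
    realBits (q : ℝ) = Nat.size q.num.natAbs + Nat.size q.den := by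
  have h : ∃ p : ℚ, (p : ℝ) = q := ⟨q, rfl⟩
  have hq : h.choose = q := by exact_mod_cast h.choose_spec
  rw [realBits, dif_pos h, hq]

/-- Expressions with natural number values. -/
inductive NatExp where
  | const (c : ℕ)
  | read (a : ℕ) (k : NatExp)
  | add (e f : NatExp)
  | sub (e f : NatExp)

namespace NatExp

/-- The value; subtraction is truncated. -/
def eval (m : Memory) : NatExp → ℕ
  | const c => c
  | read a k => m.nat a (k.eval m)
  | add e f => e.eval m + f.eval m
  | sub e f => e.eval m - f.eval m

/-- The number of operations. -/
def time : NatExp → ℕ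
  | const _ => 1
  | read _ k => k.time + 1
  | add e f => e.time + f.time + 1
  | sub e f => e.time + f.time + 1

/-- The logarithmic cost: each operation costs one more than the length of its result, in addition
to the cost of computing its operands. -/
def bits (m : Memory) : NatExp → ℕ
  | const c => Nat.size c + 1
  | read a k => k.bits m + Nat.size (eval m (read a k)) + 1
  | add e f => e.bits m + f.bits m + Nat.size (eval m (add e f)) + 1
  | sub e f => e.bits m + f.bits m + Nat.size (eval m (sub e f)) + 1

end NatExp

/-- Expressions with real values. -/
inductive RealExp where
  | read (a : ℕ) (k : NatExp)
  | add (e f : RealExp)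
  | sub (e f : RealExp)

namespace RealExp

/-- The value. -/
noncomputable def eval (m : Memory) : RealExp → ℝ
  | read a k => m.real a (k.eval m)
  | add e f => e.eval m + f.eval m
  | sub e f => e.eval m - f.eval m

/-- The number of operations. -/
def time : RealExp → ℕ
  | read _ k => k.time + 1
  | add e f => e.time + f.time + 1
  | sub e f => e.time + f.time + 1

/-- The logarithmic cost. -/
noncomputable def bits (m : Memory) : RealExp → ℕ
  | read a k => k.bits m + realBits (eval m (read a k)) + 1
  | add e f => e.bits m + f.bits m + realBits (eval m (add e f)) + 1
  | sub e f => e.bits m + f.bits m + realBits (eval m (sub e f)) + 1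

end RealExp

/-- Tests: comparisons of numbers and their Boolean combinations. -/
inductive Test where
  | natLt (e f : NatExp)
  | realLt (e f : RealExp)
  | not (b : Test)
  | and (b c : Test)

namespace Test

/-- The test succeeds. -/
def Holds (m : Memory) : Test → Prop
  | natLt e f => e.eval m < f.eval m
  | realLt e f => e.eval m < f.eval m
  | not b => ¬ b.Holds m
  | and b c => b.Holds m ∧ c.Holds m

/-- The number of operations. -/
def time : Test → ℕ
  | natLt e f => e.time + f.time + 1
  | realLt e f => e.time + f.time + 1
  | not b => b.time + 1
  | and b c => b.time + c.time + 1

/-- The logarithmic cost. -/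
noncomputable def bits (m : Memory) : Test → ℕ
  | natLt e f => e.bits m + f.bits m + 1
  | realLt e f => e.bits m + f.bits m + 1
  | not b => b.bits m + 1
  | and b c => b.bits m + c.bits m + 1

end Test

/-- Programs. -/
inductive Program where
  | skip
  | setNat (a : ℕ) (k : NatExp) (e : NatExp)
  | setReal (a : ℕ) (k : NatExp) (e : RealExp)
  | seq (p q : Program)
  | ifElse (b : Test) (p q : Program)
  | while (b : Test) (p : Program)

/-- `Runs p m t c m'`: the program `p`, started with memory `m`, halts with memory `m'` after
exactly `t` operations, whose total logarithmic cost is `c`. -/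
inductive Runs : Program → Memory → ℕ → ℕ → Memory → Prop
  | skip (m : Memory) : Runs .skip m 1 1 m
  | setNat (a : ℕ) (k e : NatExp) (m : Memory) :
      Runs (.setNat a k e) m (k.time + e.time + 1) (k.bits m + e.bits m + 1)
        (m.setNat a (k.eval m) (e.eval m))
  | setReal (a : ℕ) (k : NatExp) (e : RealExp) (m : Memory) :
      Runs (.setReal a k e) m (k.time + e.time + 1) (k.bits m + e.bits m + 1)
        (m.setReal a (k.eval m) (e.eval m))
  | seq {p q : Program} {m m' m'' : Memory} {t u c d : ℕ} :
      Runs p m t c m' → Runs q m' u d m'' → Runs (.seq p q) m (t + u) (c + d) m''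
  | ifTrue {b : Test} {p q : Program} {m m' : Memory} {t c : ℕ} :
      b.Holds m → Runs p m t c m' → Runs (.ifElse b p q) m (b.time + t) (b.bits m + c) m'
  | ifFalse {b : Test} {p q : Program} {m m' : Memory} {t c : ℕ} :
      ¬ b.Holds m → Runs q m t c m' → Runs (.ifElse b p q) m (b.time + t) (b.bits m + c) m'
  | whileFalse {b : Test} {p : Program} {m : Memory} :
      ¬ b.Holds m → Runs (.while b p) m b.time (b.bits m) m
  | whileTrue {b : Test} {p : Program} {m m' m'' : Memory} {t u c d : ℕ} :
      b.Holds m → Runs p m t c m' → Runs (.while b p) m' u d m'' →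
        Runs (.while b p) m (b.time + t + u) (b.bits m + c + d) m''

/-- Cell `k` of an array that holds the vector `x` in its first `n` cells and is zero elsewhere. -/
noncomputable def loadVec {n : ℕ} (x : Fin n → ℝ) (k : ℕ) : ℝ :=
  if h : k < n then x ⟨k, h⟩ else 0

namespace Input

variable {n : ℕ}

/-- The memory at the start: cell `0` of the array `0` of natural numbers holds `n`, cell `0` of the
array `0` of real numbers holds the error threshold, and the arrays `1`, `2`, `3`, `4` of real
numbers hold the left ends, the right ends, the actual values and the costs. All other cells are
zero. -/
noncomputable def initialMemory (I : Input n) : Memory where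
  nat a k := if a = 0 ∧ k = 0 then n else 0
  real a k :=
    match a with
    | 0 => if k = 0 then I.delta else 0
    | 1 => loadVec I.lo k
    | 2 => loadVec I.hi k
    | 3 => loadVec I.val k
    | 4 => loadVec I.cost k
    | _ => 0

/-- All the numbers in the input are rational. -/
def IsRational (I : Input n) : Prop :=
  (∃ q : ℚ, (q : ℝ) = I.delta) ∧
    ∀ i, (∃ q : ℚ, (q : ℝ) = I.lo i) ∧ (∃ q : ℚ, (q : ℝ) = I.hi i) ∧
      (∃ q : ℚ, (q : ℝ) = I.val i) ∧ ∃ q : ℚ, (q : ℝ) = I.cost i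

/-- The length of a rational input in binary. -/
noncomputable def bitLength (I : Input n) : ℕ :=
  n + realBits I.delta +
    ∑ i, (realBits (I.lo i) + realBits (I.hi i) + realBits (I.val i) + realBits (I.cost i))

end Input

/-- The set of items that a memory describes as output: item `i` belongs to it if cell `i` of the
array `1` of natural numbers is not zero. -/
def outputSet (n : ℕ) (m : Memory) : Finset (Fin n) :=
  {i | m.nat 1 i ≠ 0}

end QuerySort

/-!
The theorem combines a description of the query sets that prove an ordering, an algorithm for
weighted independent sets in chordal graphs, and an implementation on the machine.

*Query sets.* After the queries in `Q`, item `i` can have any value in an interval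
`[low i, high i]`, and `Q` proves an ordering if and only if any two items `i ≠ j` are comparable,
that is, `high i ≤ low j + δ` or `high j ≤ low i + δ`: pairwise comparability suffices because
ordering the items by the midpoints of these intervals satisfies every pair
(`Input.provesOrdering_iff_pairwise`). Comparability means exactly that `Q` contains the forced
items and covers the edges of the dependency graph (`Input.provesOrdering_iff`). So the complements
of the optimum query sets are the independent sets of maximum weight among the items that are not
forced, and giving the forced items weight zero removes the restriction
(`Input.isOptimumQuerySet_compl`).

*Chordality.* If `j` and `k` are adjacent to `i` and their intervals do not end before the interval
of `i`, then `j` and `k` are adjacent (`Input.depGraph_adj_of_hi_le`). Hence the order of the right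
ends is a perfect elimination order, and in an induced cycle the neighbours of the vertex with the
smallest right end would be adjacent.

*Independent sets.* The algorithm is Frank's. As long as a weight is positive, select the vertex `b`
of positive weight with the smallest right end, and subtract its weight from all weights in its
closed neighbourhood. The vertices of positive weight in this neighbourhood form a clique, so the
weight of an independent set drops by no more than the weight of `b`. Then go through the selected
vertices in reverse order and insert each one that has no neighbour in the set built so far; the
resulting set meets the neighbourhood of every selected vertex, and so it loses the full amount in
every step (`IsMaxWeightIndepSet.insertIfFree`).

*Implementation.* The program consists of nested loops over the items. Its correctness and its
quadratic time bound are proved with a small calculus of total correctness (`Ensures`), whose rule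
for loops is `ensures_loop`. The logarithmic cost needs no separate analysis: additions and
subtractions preserve a common denominator and lengthen a number by at most one binary digit, so
`t` operations on numbers of at most `s` digits cost `O(t * (s + t))`, and a program that takes
polynomial time has polynomial logarithmic cost (`Input.exists_cost_polynomial`).
-/

namespace QuerySort

/-! ### Query sets that prove an ordering -/

namespace Input

variable {n : ℕ}

/-- The least value of item `i` that is possible after the queries in `Q`. -/
noncomputable def low (I : Input n) (Q : Finset (Fin n)) (i : Fin n) : ℝ :=
  if i ∈ Q then I.val i else I.lo i

/-- The greatest value of item `i` that is possible after the queries in `Q`. -/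
noncomputable def high (I : Input n) (Q : Finset (Fin n)) (i : Fin n) : ℝ :=
  if i ∈ Q then I.val i else I.hi i

theorem Consistent.mem_Icc {I : Input n} {Q : Finset (Fin n)} {x : Fin n → ℝ}
    (hx : I.Consistent Q x) (i : Fin n) : I.low Q i ≤ x i ∧ x i ≤ I.high Q i := by
  unfold low high
  split_ifs with h
  · simp [hx.2 i h]
  · exact hx.1 i

theorem consistent_of_extreme (I : Input n) (Q : Finset (Fin n)) {x : Fin n → ℝ}
    (hx : ∀ i, x i = I.low Q i ∨ x i = I.high Q i) : I.Consistent Q x := by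
  refine ⟨fun i => ?_, fun i hi => ?_⟩
  · have h₁ := I.lo_le_val i
    have h₂ := I.val_le_hi i
    rcases hx i with h | h <;> rw [h] <;> simp only [low, high] <;> split_ifs <;>
      constructor <;> linarith
  · rcases hx i with h | h <;> simp [h, low, high, hi]

/-- Ordering the items by the midpoints of what remains of their intervals turns pairwise
comparability into a common ordering. -/
theorem provesOrdering_iff_pairwise (I : Input n) (Q : Finset (Fin n)) :
    I.ProvesOrdering Q ↔ ∀ i j, i ≠ j →
      I.high Q i ≤ I.low Q j + I.delta ∨ I.high Q j ≤ I.low Q i + I.delta := by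
  constructor
  · rintro ⟨π, hπ⟩
    have key : ∀ i j, π i < π j → I.high Q i ≤ I.low Q j + I.delta := by
      intro i j hij
      have hne : j ≠ i := by rintro rfl; exact lt_irrefl _ hij
      have := hπ (fun k => if k = i then I.high Q k else I.low Q k)
        (I.consistent_of_extreme Q fun k => by by_cases hk : k = i <;> simp [hk]) i j hij
      simpa [hne] using this
    intro i j hij
    rcases lt_trichotomy (π i) (π j) with h | h | h
    · exact Or.inl (key i j h)
    · exact absurd (π.injective h) hij
    · exact Or.inr (key j i h)
  · intro h
    let f : Fin n → ℝ := fun i => I.low Q i + I.high Q i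
    refine ⟨(Tuple.sort f)⁻¹, fun x hx i j hij => ?_⟩
    have hf : f i ≤ f j := by
      have := Tuple.monotone_sort f hij.le
      simpa using this
    have hne : i ≠ j := by rintro rfl; exact lt_irrefl _ hij
    have hi := (hx.mem_Icc i).2
    have hj := (hx.mem_Icc j).1
    simp only [f] at hf
    rcases h i j hne with h | h <;> linarith

theorem mem_forced (I : Input n) (j : Fin n) :
    j ∈ I.forced ↔ ∃ i, i ≠ j ∧ I.lo j < I.val i - I.delta ∧ I.val i + I.delta < I.hi j := by
  simp [forced]

theorem provesOrdering_iff (I : Input n) (Q : Finset (Fin n)) :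
    I.ProvesOrdering Q ↔ I.forced ⊆ Q ∧ I.depGraph.IsVertexCover (Q : Set (Fin n)) := by
  rw [provesOrdering_iff_pairwise]
  have hδ := I.delta_nonneg
  constructor
  · intro h
    refine ⟨fun j hj => ?_, fun i j hij => ?_⟩
    · obtain ⟨i, hij, h₁, h₂⟩ := (I.mem_forced j).1 hj
      by_contra hjQ
      have hi₁ := I.lo_le_val i
      have hi₂ := I.val_le_hi i
      have := h i j hij
      simp only [low, high, hjQ, if_false] at this
      split_ifs at this <;> rcases this with h | h <;> linarith
    · by_contra! hc
      obtain ⟨hne, h₁, h₂⟩ := hij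
      have hi : i ∉ Q := hc.1
      have hj : j ∉ Q := hc.2
      have := h i j hne
      simp only [low, high, hi, hj, if_false] at this
      rcases this with h | h <;> linarith
  · rintro ⟨hF, hC⟩ i j hne
    have forced_mem : ∀ i j, i ≠ j → j ∉ Q →
        I.val i ≤ I.lo j + I.delta ∨ I.hi j ≤ I.val i + I.delta := by
      intro i j hne hj
      by_contra! hc
      exact hj (hF ((I.mem_forced j).2 ⟨i, hne, by linarith, by linarith⟩))
    by_cases hi : i ∈ Q <;> by_cases hj : j ∈ Q <;> simp only [low, high, hi, hj, if_true, if_false]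
    · rcases le_total (I.val i) (I.val j) with h | h
      · left; linarith
      · right; linarith
    · exact forced_mem i j hne hj
    · exact (forced_mem j i hne.symm hi).symm
    · by_contra! hc
      rcases hC (show I.depGraph.Adj i j from ⟨hne, by linarith, by linarith⟩) with h | h
      · exact hi h
      · exact hj h

/-! ### Chordality of the dependency graph -/

/-- An item whose interval has the smallest right end is simplicial in the dependency graph. -/
theorem depGraph_adj_of_hi_le (I : Input n) {i j k : Fin n} (hj : I.hi i ≤ I.hi j)
    (hk : I.hi i ≤ I.hi k) (hij : I.depGraph.Adj i j) (hik : I.depGraph.Adj i k) (hjk : j ≠ k) :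
    I.depGraph.Adj j k :=
  ⟨hjk, by linarith [hik.2.1], by linarith [hij.2.1]⟩

end Input

/-- A graph is chordal if, for some valuation of the vertices, every vertex is simplicial among the
vertices that have no smaller value. -/
theorem isChordal_of_simplicial {V : Type*} {G : SimpleGraph V} (key : V → ℝ)
    (h : ∀ i j k, key i ≤ key j → key i ≤ key k → G.Adj i j → G.Adj i k → j ≠ k → G.Adj j k) :
    IsChordal G := by
  intro k hk
  obtain ⟨k, rfl⟩ := Nat.exists_eq_add_of_le' hk
  refine ⟨fun f => ?_⟩
  obtain ⟨u, hu⟩ := Finite.exists_min fun u => key (f u)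
  have h₁ : (1 : Fin (k + 4)).val = 1 := rfl
  have h₂ : ((1 : Fin (k + 4)) + 1).val = 2 := by
    rw [Fin.val_add, h₁]; exact Nat.mod_eq_of_lt (by omega)
  have adj_succ : G.Adj (f u) (f (u + 1)) := f.map_rel_iff.2 (Or.inr (by simp))
  have adj_pred : G.Adj (f u) (f (u - 1)) := f.map_rel_iff.2 (Or.inl (by simp))
  have e₁ : (u + 1) - (u - 1) = 1 + 1 := by abel
  have ne : u + 1 ≠ u - 1 := by
    intro he
    rw [he, sub_self] at e₁
    have := congrArg Fin.val e₁
    rw [h₂] at this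
    simp at this
  have := f.map_rel_iff.1
    (h _ _ _ (hu (u + 1)) (hu (u - 1)) adj_succ adj_pred (f.injective.ne ne))
  rcases (SimpleGraph.cycleGraph_adj (n := k + 2)).1 this with h | h
  · have := congrArg Fin.val (e₁.symm.trans h)
    rw [h₂, h₁] at this
    omega
  · have e₂ : (1 : Fin (k + 4)) + (1 + 1) = 0 := by
      have : u - 1 - (u + 1) + (u + 1 - (u - 1)) = 0 := by abel
      rwa [e₁, h] at this
    have := congrArg Fin.val e₂
    rw [Fin.val_add, h₂, h₁, Nat.mod_eq_of_lt (by omega)] at this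
    simp at this

theorem Input.remainingGraph_isChordal {n : ℕ} (I : Input n) : IsChordal I.remainingGraph :=
  isChordal_of_simplicial (fun i => I.hi i) fun _ _ _ hj hk hij hik hjk =>
    I.depGraph_adj_of_hi_le hj hk hij hik (Subtype.val_injective.ne hjk)

/-! ### Independent sets of maximum weight in a chordal graph -/

section MaxWeight

variable {V : Type*} (G : SimpleGraph V)

/-- `j` belongs to the closed neighbourhood of `i`. -/
def Near (i j : V) : Prop := i = j ∨ G.Adj i j

/-- `S` is an independent set of maximum weight, and its vertices have positive weight. Negative
weights count as zero. -/
structure IsMaxWeightIndepSet (w : V → ℝ) (S : Finset V) : Prop where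
  pos : ∀ s ∈ S, 0 < w s
  indep : G.IsIndepSet (S : Set V)
  le_sum : ∀ T : Finset V, G.IsIndepSet (T : Set V) → ∑ v ∈ T, max (w v) 0 ≤ ∑ v ∈ S, w v

open Classical in
/-- Lower the weights in the closed neighbourhood of `b` by the weight of `b`. -/
noncomputable def lower (w : V → ℝ) (b : V) : V → ℝ :=
  fun j => if Near G b j then w j - w b else w j

open Classical in
/-- Add `b` to `S` unless a neighbour of `b` belongs to `S`. -/
noncomputable def insertIfFree (b : V) (S : Finset V) : Finset V :=
  if ∃ s ∈ S, Near G b s then S else insert b S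

variable {G}

theorem isMaxWeightIndepSet_empty {w : V → ℝ} (hw : ∀ v, w v ≤ 0) :
    IsMaxWeightIndepSet G w ∅ where
  pos := by simp
  indep := by simp
  le_sum T _ := by simp [max_eq_right (hw _)]

theorem lower_self (w : V → ℝ) (b : V) : lower G w b b = 0 := by simp [lower, Near]

theorem lower_le {w : V → ℝ} {b : V} (hb : 0 ≤ w b) (j : V) : lower G w b j ≤ w j := by
  unfold lower; split_ifs <;> linarith

/-- The closed neighbourhood of a simplicial vertex `b` is a clique, so an independent set loses at
most the weight of `b` when the weights are lowered at `b`; a set completed by `insertIfFree` meets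
the neighbourhood and loses at least that much. -/
theorem IsMaxWeightIndepSet.insertIfFree {w : V → ℝ} {b : V} {S : Finset V} (hb : 0 < w b)
    (clique : ∀ i j, 0 < w i → 0 < w j → Near G b i → Near G b j → i ≠ j → G.Adj i j)
    (hS : IsMaxWeightIndepSet G (lower G w b) S) :
    IsMaxWeightIndepSet G w (insertIfFree G b S) := by
  classical
  have hpos : ∀ s ∈ S, 0 < w s := fun s hs => (hS.pos s hs).trans_le (lower_le hb.le s)
  have hbS : b ∉ S := fun h => by simpa [lower_self] using hS.pos b h
  refine ⟨fun s hs => ?_, ?_, fun T hT => ?_⟩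
  · unfold QuerySort.insertIfFree at hs
    split_ifs at hs
    · exact hpos s hs
    · rcases Finset.mem_insert.1 hs with rfl | hs
      · exact hb
      · exact hpos s hs
  · unfold QuerySort.insertIfFree
    split_ifs with h
    · exact hS.indep
    · push Not at h
      intro x hx y hy hxy hadj
      rw [Finset.mem_coe, Finset.mem_insert] at hx hy
      rcases hx with rfl | hx <;> rcases hy with rfl | hy
      · exact hxy rfl
      · exact h y hy (Or.inr hadj)
      · exact h x hx (Or.inr hadj.symm)
      · exact hS.indep hx hy hxy hadj
  · have h₁ : ∑ v ∈ T, max (w v) 0 ≤ ∑ v ∈ S, lower G w b v + w b := by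
      have hcard : #{v ∈ T | Near G b v ∧ 0 < w v} ≤ 1 := by
        refine Finset.card_le_one.2 fun i hi j hj => ?_
        rw [Finset.mem_filter] at hi hj
        by_contra hij
        exact hT hi.1 hj.1 hij (clique i j hi.2.2 hj.2.2 hi.2.1 hj.2.1 hij)
      calc ∑ v ∈ T, max (w v) 0
          ≤ ∑ v ∈ T, (max (lower G w b v) 0 + if Near G b v ∧ 0 < w v then w b else 0) := by
            refine Finset.sum_le_sum fun v _ => ?_
            by_cases hv : 0 < w v
            · by_cases hn : Near G b v
              · simp only [lower, hn, hv, and_self, if_true]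
                exact max_le (by linarith [le_max_left (w v - w b) 0])
                  (by linarith [le_max_right (w v - w b) 0])
              · simp [lower, hn]
            · simp [max_eq_right (not_lt.1 hv), hv]
        _ = ∑ v ∈ T, max (lower G w b v) 0 + #{v ∈ T | Near G b v ∧ 0 < w v} * w b := by
            rw [Finset.sum_add_distrib, ← Finset.sum_filter, Finset.sum_const, nsmul_eq_mul]
        _ ≤ ∑ v ∈ S, lower G w b v + w b := by
            have : (#{v ∈ T | Near G b v ∧ 0 < w v} : ℝ) ≤ 1 := by exact_mod_cast hcard
            exact add_le_add (hS.le_sum T hT) (by nlinarith)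
    refine h₁.trans ?_
    unfold QuerySort.insertIfFree
    split_ifs with h
    · obtain ⟨s, hs, hn⟩ := h
      rw [← Finset.add_sum_erase _ _ hs, ← Finset.add_sum_erase S w hs]
      have : ∑ v ∈ S.erase s, lower G w b v ≤ ∑ v ∈ S.erase s, w v :=
        Finset.sum_le_sum fun v _ => lower_le hb.le v
      have : lower G w b s = w s - w b := by simp [lower, hn]
      linarith
    · push Not at h
      rw [Finset.sum_insert hbS, add_comm]
      refine le_of_eq (congrArg _ (Finset.sum_congr rfl fun v hv => ?_))
      simp [lower, h v hv]

end MaxWeight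

/-! ### From independent sets to query sets -/

namespace Input

variable {n : ℕ}

open Classical in
/-- The weights of the items: the cost, except that forced items have weight zero. -/
noncomputable def weight (I : Input n) (i : Fin n) : ℝ := if i ∈ I.forced then 0 else I.cost i

theorem weight_nonneg (I : Input n) (i : Fin n) : 0 ≤ I.weight i := by
  unfold weight; split_ifs <;> simp [I.cost_nonneg]

theorem isOptimumQuerySet_compl (I : Input n) {S : Finset (Fin n)}
    (hS : IsMaxWeightIndepSet I.depGraph I.weight S) : I.IsOptimumQuerySet Sᶜ := by
  constructor
  · rw [provesOrdering_iff]
    refine ⟨fun j hj => ?_, ?_⟩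
    · rw [Finset.mem_compl]
      intro hjS
      simpa [weight, hj] using hS.pos j hjS
    · simpa using hS.indep
  · intro Q hQ
    rw [provesOrdering_iff] at hQ
    have hT := hS.le_sum Qᶜ (by simpa using hQ.2)
    have h₁ : ∑ v ∈ Qᶜ, max (I.weight v) 0 = ∑ v ∈ Qᶜ, I.cost v := by
      refine Finset.sum_congr rfl fun v hv => ?_
      rw [max_eq_left (I.weight_nonneg v), weight,
        if_neg fun h => (Finset.mem_compl.1 hv) (hQ.1 h)]
    have h₂ : ∑ v ∈ S, I.weight v ≤ ∑ v ∈ S, I.cost v := by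
      refine Finset.sum_le_sum fun v _ => ?_
      unfold weight; split_ifs <;> simp [I.cost_nonneg]
    have h₃ := Finset.sum_compl_add_sum S I.cost
    have h₄ := Finset.sum_compl_add_sum Q I.cost
    linarith

/-- An optimum query set consists of the forced items and a vertex cover of minimum weight of the
graph that remains. -/
theorem IsOptimumQuerySet.exists_cover {I : Input n} {Q : Finset (Fin n)}
    (hQ : I.IsOptimumQuerySet Q) :
    ∃ C : Finset {i : Fin n // i ∉ I.forced},
      Q = I.forced ∪ C.map (Function.Embedding.subtype _) ∧
      IsMinWeightVertexCover I.remainingGraph (fun i => I.cost i) C := by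
  classical
  have hsum : ∀ D : Finset {i : Fin n // i ∉ I.forced},
      ∑ i ∈ I.forced ∪ D.map (Function.Embedding.subtype _), I.cost i =
        ∑ i ∈ I.forced, I.cost i + ∑ i ∈ D, I.cost i := by
    intro D
    rw [Finset.sum_union, Finset.sum_map]
    · rfl
    · rw [Finset.disjoint_left]
      intro i hi hD
      obtain ⟨x, -, rfl⟩ := Finset.mem_map.1 hD
      exact x.2 hi
  obtain ⟨hF, hC⟩ := (I.provesOrdering_iff Q).1 hQ.1
  have hQC : Q = I.forced ∪ (Q.subtype (· ∉ I.forced)).map (Function.Embedding.subtype _) := by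
    ext i
    simp only [Finset.mem_union, Finset.mem_map, Finset.mem_subtype,
      Function.Embedding.subtype_apply, Subtype.exists, exists_and_right, exists_eq_right]
    by_cases h : i ∈ I.forced
    · simp [h, hF h]
    · simp [h]
  refine ⟨Q.subtype (· ∉ I.forced), hQC, fun i j hij => ?_, fun D hD => ?_⟩
  · simpa using hC hij
  · have hD' : I.ProvesOrdering (I.forced ∪ D.map (Function.Embedding.subtype _)) := by
      rw [provesOrdering_iff]
      refine ⟨Finset.subset_union_left, fun i j hij => ?_⟩
      by_cases hi : i ∈ I.forced
      · simp [hi]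
      by_cases hj : j ∈ I.forced
      · simp [hj]
      have := hD (show I.remainingGraph.Adj ⟨i, hi⟩ ⟨j, hj⟩ from hij)
      simpa [hi, hj] using this
    have := hQ.2 _ hD'
    rw [hQC, hsum, hsum] at this
    simpa using this

end Input

/-! ### The logarithmic cost is polynomial in the number of operations -/

/-- `x` is a fraction with denominator `D` whose numerator has at most `s` binary digits. -/
def IsFraction (D s : ℕ) (x : ℝ) : Prop := ∃ z : ℤ, x * D = z ∧ z.natAbs < 2 ^ s

theorem IsFraction.mono {D s s' : ℕ} {x : ℝ} (h : IsFraction D s x) (hs : s ≤ s') :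
    IsFraction D s' x := by
  obtain ⟨z, hz, hlt⟩ := h
  exact ⟨z, hz, hlt.trans_le (Nat.pow_le_pow_right two_pos hs)⟩

theorem two_pow_add_two_pow_le {a b s : ℕ} (ha : a < s) (hb : b < s) : 2 ^ a + 2 ^ b ≤ 2 ^ s :=
  calc 2 ^ a + 2 ^ b ≤ 2 ^ (s - 1) + 2 ^ (s - 1) :=
        add_le_add (Nat.pow_le_pow_right two_pos (by omega))
          (Nat.pow_le_pow_right two_pos (by omega))
    _ = 2 ^ (s - 1 + 1) := by rw [pow_succ]; ring
    _ = 2 ^ s := by congr 1; omega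

theorem IsFraction.add {D s t u : ℕ} {x y : ℝ} (hx : IsFraction D s x) (hy : IsFraction D t y)
    (hs : s < u) (ht : t < u) : IsFraction D u (x + y) := by
  obtain ⟨z, hz, hzlt⟩ := hx
  obtain ⟨z', hz', hzlt'⟩ := hy
  refine ⟨z + z', by push_cast; linarith, ?_⟩
  have h₁ := Int.natAbs_add_le z z'
  have h₂ := two_pow_add_two_pow_le hs ht
  omega

theorem IsFraction.sub {D s t u : ℕ} {x y : ℝ} (hx : IsFraction D s x) (hy : IsFraction D t y)
    (hs : s < u) (ht : t < u) : IsFraction D u (x - y) := by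
  obtain ⟨z, hz, hzlt⟩ := hy
  rw [sub_eq_add_neg]
  exact hx.add ⟨-z, by push_cast; linarith, by rwa [Int.natAbs_neg]⟩ hs ht

theorem IsFraction.realBits_le {D s : ℕ} {x : ℝ} (hD : 0 < D) (hDs : D < 2 ^ s)
    (hx : IsFraction D s x) : realBits x ≤ 2 * s := by
  obtain ⟨z, hz, hlt⟩ := hx
  have hD' : (D : ℝ) ≠ 0 := by exact_mod_cast hD.ne'
  have hx : x = ((Rat.divInt z D : ℚ) : ℝ) := by
    rw [Rat.divInt_eq_div]
    push_cast
    rw [← hz, mul_div_cancel_right₀ _ hD']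
  rw [hx, realBits_ratCast]
  have h₁ : (Rat.divInt z D).num.natAbs < 2 ^ s := by
    rcases eq_or_ne z 0 with rfl | hz0
    · simp
    · exact (Nat.le_of_dvd (Int.natAbs_pos.2 hz0) (Int.natAbs_dvd_natAbs.2
        (Rat.num_dvd z (by exact_mod_cast hD.ne')))).trans_lt hlt
  have h₂ : (Rat.divInt z D).den < 2 ^ s :=
    (Nat.le_of_dvd hD (by exact_mod_cast Rat.den_dvd z D)).trans_lt hDs
  have := Nat.size_le.2 h₁
  have := Nat.size_le.2 h₂
  omega

/-- All numbers in the memory are small: the natural numbers have at most `s` binary digits, and the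
real numbers are fractions with denominator `D` whose numerators have at most `s` digits. -/
structure Memory.BoundedBy (m : Memory) (D s : ℕ) : Prop where
  nat_lt : ∀ a k, m.nat a k < 2 ^ s
  isFraction : ∀ a k, IsFraction D s (m.real a k)

theorem Memory.BoundedBy.mono {m : Memory} {D s s' : ℕ} (h : m.BoundedBy D s) (hs : s ≤ s') :
    m.BoundedBy D s' :=
  ⟨fun a k => (h.nat_lt a k).trans_le (Nat.pow_le_pow_right two_pos hs),
    fun a k => (h.isFraction a k).mono hs⟩

/-- The total length of the numerals in an expression. -/
def NatExp.constSize : NatExp → ℕ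
  | const c => Nat.size c
  | read _ k => k.constSize
  | add e f => e.constSize + f.constSize
  | sub e f => e.constSize + f.constSize

/-- The total length of the numerals in an expression. -/
def RealExp.constSize : RealExp → ℕ
  | read _ k => k.constSize
  | add e f => e.constSize + f.constSize
  | sub e f => e.constSize + f.constSize

/-- The total length of the numerals in a test. -/
def Test.constSize : Test → ℕ
  | natLt e f => e.constSize + f.constSize
  | realLt e f => e.constSize + f.constSize
  | not b => b.constSize
  | and b c => b.constSize + c.constSize

/-- The total length of the numerals in a program. -/
def Program.constSize : Program → ℕ
  | skip => 0
  | setNat _ k e => k.constSize + e.constSize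
  | setReal _ k e => k.constSize + e.constSize
  | seq p q => p.constSize + q.constSize
  | ifElse b p q => b.constSize + p.constSize + q.constSize
  | .while b p => b.constSize + p.constSize

/-- If `a` operations cost at most `k` each, `b` operations cost at most `l` each, and one more
operation costs `c`, then they cost at most `u` each, where `u` bounds `k`, `l` and `c`. -/
theorem add_mul_le {a b c k l u x y : ℕ} (hx : x ≤ a * k) (hy : y ≤ b * l) (hk : k ≤ u) (hl : l ≤ u)
    (hc : c ≤ u) : x + y + c ≤ (a + b + 1) * u := by
  have := Nat.mul_le_mul_left a hk
  have := Nat.mul_le_mul_left b hl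
  linarith

section Bounds

variable {m : Memory} {D s : ℕ}

theorem NatExp.eval_lt_and_bits_le (hm : m.BoundedBy D s) (e : NatExp) (he : e.constSize ≤ s) :
    e.eval m < 2 ^ (s + e.time) ∧ e.bits m ≤ e.time * (2 * (s + e.time) + 1) := by
  induction e with
  | const c =>
    have hc : c < 2 ^ (s + 1) := (Nat.lt_size_self c).trans_le
      (Nat.pow_le_pow_right two_pos (by simp only [constSize] at he; omega))
    refine ⟨hc, ?_⟩
    simp only [bits, time, constSize] at *
    omega
  | read a k ih =>
    have hlt : NatExp.eval m (read a k) < 2 ^ s := hm.nat_lt _ _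
    refine ⟨hlt.trans_le (Nat.pow_le_pow_right two_pos (by omega)), ?_⟩
    have := Nat.size_le.2 hlt
    simp only [bits, time] at *
    have := add_mul_le (b := 0) (l := 0) (y := 0) (c := (eval m (read a k)).size + 1)
      (u := 2 * (s + (k.time + 1)) + 1) (ih he).2 le_rfl (by omega) (by omega) (by omega)
    linarith
  | add e f ihe ihf =>
    simp only [constSize] at he
    obtain ⟨he₁, he₂⟩ := ihe (by omega)
    obtain ⟨hf₁, hf₂⟩ := ihf (by omega)
    have hlt : NatExp.eval m (add e f) < 2 ^ (s + (add e f).time) :=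
      (Nat.add_lt_add he₁ hf₁).trans_le
        (two_pow_add_two_pow_le (by simp only [time]; omega) (by simp only [time]; omega))
    refine ⟨hlt, ?_⟩
    have := Nat.size_le.2 hlt
    simp only [bits, time] at *
    rw [add_assoc (_ + _)]
    exact add_mul_le he₂ hf₂ (by omega) (by omega) (by omega)
  | sub e f ihe ihf =>
    simp only [constSize] at he
    obtain ⟨he₁, he₂⟩ := ihe (by omega)
    obtain ⟨hf₁, hf₂⟩ := ihf (by omega)
    have hlt : NatExp.eval m (sub e f) < 2 ^ (s + (sub e f).time) :=
      ((Nat.sub_le _ _).trans_lt he₁).trans_le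
        (Nat.pow_le_pow_right two_pos (by simp only [time]; omega))
    refine ⟨hlt, ?_⟩
    have := Nat.size_le.2 hlt
    simp only [bits, time] at *
    rw [add_assoc (_ + _)]
    exact add_mul_le he₂ hf₂ (by omega) (by omega) (by omega)

theorem RealExp.isFraction_and_bits_le (hD : 0 < D) (hDs : D < 2 ^ s) (hm : m.BoundedBy D s)
    (e : RealExp) (he : e.constSize ≤ s) :
    IsFraction D (s + e.time) (e.eval m) ∧ e.bits m ≤ e.time * (2 * (s + e.time) + 1) := by
  have size_le : ∀ (t : ℕ) (x : ℝ), IsFraction D (s + t) x → realBits x ≤ 2 * (s + t) :=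
    fun t x hx => hx.realBits_le hD (hDs.trans_le (Nat.pow_le_pow_right two_pos (by omega)))
  induction e with
  | read a k =>
    have hx : IsFraction D s (RealExp.eval m (read a k)) := hm.isFraction _ _
    refine ⟨hx.mono (by omega), ?_⟩
    have := size_le 0 _ hx
    simp only [bits, time] at *
    have := add_mul_le (b := 0) (l := 0) (y := 0) (c := realBits (eval m (read a k)) + 1)
      (u := 2 * (s + (k.time + 1)) + 1) (k.eval_lt_and_bits_le hm he).2 le_rfl (by omega)
      (by omega) (by omega)
    linarith
  | add e f ihe ihf =>
    simp only [constSize] at he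
    obtain ⟨he₁, he₂⟩ := ihe (by omega)
    obtain ⟨hf₁, hf₂⟩ := ihf (by omega)
    have hx : IsFraction D (s + (add e f).time) (RealExp.eval m (add e f)) :=
      he₁.add hf₁ (by simp only [time]; omega) (by simp only [time]; omega)
    refine ⟨hx, ?_⟩
    have := size_le _ _ hx
    simp only [bits, time] at *
    rw [add_assoc (_ + _)]
    exact add_mul_le he₂ hf₂ (by omega) (by omega) (by omega)
  | sub e f ihe ihf =>
    simp only [constSize] at he
    obtain ⟨he₁, he₂⟩ := ihe (by omega)
    obtain ⟨hf₁, hf₂⟩ := ihf (by omega)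
    have hx : IsFraction D (s + (sub e f).time) (RealExp.eval m (sub e f)) :=
      he₁.sub hf₁ (by simp only [time]; omega) (by simp only [time]; omega)
    refine ⟨hx, ?_⟩
    have := size_le _ _ hx
    simp only [bits, time] at *
    rw [add_assoc (_ + _)]
    exact add_mul_le he₂ hf₂ (by omega) (by omega) (by omega)

theorem Test.bits_le (hD : 0 < D) (hDs : D < 2 ^ s) (hm : m.BoundedBy D s) (b : Test)
    (hb : b.constSize ≤ s) : b.bits m ≤ b.time * (2 * (s + b.time) + 1) := by
  induction b with
  | natLt e f =>
    simp only [constSize, bits, time] at *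
    exact add_mul_le (e.eval_lt_and_bits_le hm (by omega)).2
      (f.eval_lt_and_bits_le hm (by omega)).2 (by omega) (by omega) (by omega)
  | realLt e f =>
    simp only [constSize, bits, time] at *
    exact add_mul_le (e.isFraction_and_bits_le hD hDs hm (by omega)).2
      (f.isFraction_and_bits_le hD hDs hm (by omega)).2 (by omega) (by omega) (by omega)
  | not b ih =>
    simp only [constSize, bits, time] at *
    have := add_mul_le (b := 0) (l := 0) (y := 0) (c := 1) (u := 2 * (s + (b.time + 1)) + 1)
      (ih hb) le_rfl (by omega) (by omega) (by omega)
    linarith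
  | and b c ihb ihc =>
    simp only [constSize, bits, time] at *
    exact add_mul_le (ihb (by omega)) (ihc (by omega)) (by omega) (by omega) (by omega)

end Bounds

/-- Addition and subtraction keep a common denominator and lengthen numbers by at most one digit, so
no number gets longer than the numbers in the beginning by more than the number of operations. -/
theorem Runs.boundedBy_and_cost_le {p : Program} {m m' : Memory} {t c : ℕ} (h : Runs p m t c m')
    {D s : ℕ} (hD : 0 < D) (hDs : D < 2 ^ s) (hm : m.BoundedBy D s) (hp : p.constSize ≤ s) :
    m'.BoundedBy D (s + t) ∧ c ≤ t * (2 * (s + t) + 1) := by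
  have up : ∀ s t, s ≤ t → D < 2 ^ s → D < 2 ^ t :=
    fun s t h hs => hs.trans_le (Nat.pow_le_pow_right two_pos h)
  have add_le : ∀ {a b k l u x y : ℕ}, x ≤ a * k → y ≤ b * l → k ≤ u → l ≤ u →
      x + y ≤ (a + b) * u := by
    intro a b k l u x y hx hy hk hl
    have := Nat.mul_le_mul_left a hk
    have := Nat.mul_le_mul_left b hl
    linarith
  induction h generalizing s with
  | skip m => exact ⟨hm.mono (by omega), by omega⟩
  | setNat a k e m =>
    simp only [Program.constSize] at hp
    obtain ⟨-, hk⟩ := k.eval_lt_and_bits_le hm (by omega)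
    obtain ⟨hlt, he⟩ := e.eval_lt_and_bits_le hm (by omega)
    refine ⟨⟨fun b l => ?_, fun b l => (hm.isFraction b l).mono (by omega)⟩,
      add_mul_le hk he (by omega) (by omega) (by omega)⟩
    simp only [Memory.setNat]
    split_ifs
    · exact hlt.trans_le (Nat.pow_le_pow_right two_pos (by omega))
    · exact (hm.nat_lt b l).trans_le (Nat.pow_le_pow_right two_pos (by omega))
  | setReal a k e m =>
    simp only [Program.constSize] at hp
    obtain ⟨-, hk⟩ := k.eval_lt_and_bits_le hm (by omega)
    obtain ⟨hx, he⟩ := e.isFraction_and_bits_le hD hDs hm (by omega)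
    refine ⟨⟨fun b l => (hm.nat_lt b l).trans_le (Nat.pow_le_pow_right two_pos (by omega)),
      fun b l => ?_⟩, add_mul_le hk he (by omega) (by omega) (by omega)⟩
    simp only [Memory.setReal]
    split_ifs
    · exact hx.mono (by omega)
    · exact (hm.isFraction b l).mono (by omega)
  | seq _ _ ihp ihq =>
    simp only [Program.constSize] at hp
    obtain ⟨hp₁, hp₂⟩ := ihp hDs hm (by omega)
    obtain ⟨hq₁, hq₂⟩ := ihq (up _ _ (by omega) hDs) hp₁ (by omega)
    exact ⟨hq₁.mono (by omega), add_le hp₂ hq₂ (by omega) (by omega)⟩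
  | @ifTrue b _ _ _ _ _ _ _ _ ih =>
    simp only [Program.constSize] at hp
    obtain ⟨h₁, h₂⟩ := ih hDs hm (by omega)
    exact ⟨h₁.mono (by omega),
      add_le (b.bits_le hD hDs hm (by omega)) h₂ (by omega) (by omega)⟩
  | @ifFalse b _ _ _ _ _ _ _ _ ih =>
    simp only [Program.constSize] at hp
    obtain ⟨h₁, h₂⟩ := ih hDs hm (by omega)
    exact ⟨h₁.mono (by omega),
      add_le (b.bits_le hD hDs hm (by omega)) h₂ (by omega) (by omega)⟩
  | @whileFalse b _ _ _ =>
    simp only [Program.constSize] at hp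
    exact ⟨hm.mono (by omega), b.bits_le hD hDs hm (by omega)⟩
  | @whileTrue b _ _ _ _ _ _ _ _ _ _ _ ihp ihq =>
    have hp' := hp
    simp only [Program.constSize] at hp
    obtain ⟨hp₁, hp₂⟩ := ihp hDs hm (by omega)
    obtain ⟨hq₁, hq₂⟩ := ihq (up _ _ (by omega) hDs) hp₁ (by omega)
    exact ⟨hq₁.mono (by omega), add_le (add_le (b.bits_le hD hDs hm (by omega)) hp₂
      (by omega) (by omega)) hq₂ le_rfl (by omega)⟩

/-! ### The size of the initial memory -/

namespace Input

variable {n : ℕ}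

/-- The memory at the start of a rational instance is bounded in terms of the length of the
instance; the denominator is the product of all denominators. -/
theorem exists_initialMemory_boundedBy {I : Input n} (hI : I.IsRational) :
    ∃ D : ℕ, 0 < D ∧ D < 2 ^ (2 * I.bitLength + 1) ∧
      I.initialMemory.BoundedBy D (2 * I.bitLength + 1) := by
  obtain ⟨⟨d, hd⟩, h⟩ := hI
  choose ql qh qv qc using h
  obtain ⟨lo, hlo⟩ := Classical.axiomOfChoice ql
  obtain ⟨hi, hhi⟩ := Classical.axiomOfChoice qh
  obtain ⟨va, hva⟩ := Classical.axiomOfChoice qv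
  obtain ⟨co, hco⟩ := Classical.axiomOfChoice qc
  let E : Fin n → ℕ := fun i => (lo i).den * (hi i).den * (va i).den * (co i).den
  let D : ℕ := d.den * ∏ i, E i
  let B : Fin n → ℕ := fun i => (Nat.size (lo i).num.natAbs + Nat.size (lo i).den) +
    (Nat.size (hi i).num.natAbs + Nat.size (hi i).den) +
    (Nat.size (va i).num.natAbs + Nat.size (va i).den) +
    (Nat.size (co i).num.natAbs + Nat.size (co i).den)
  have hE : ∀ i, 0 < E i := fun i => by
    have := (lo i).den_pos; have := (hi i).den_pos
    have := (va i).den_pos; have := (co i).den_pos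
    positivity
  have hD : 0 < D := mul_pos d.den_pos (Finset.prod_pos fun i _ => hE i)
  have hL : I.bitLength = n + (Nat.size d.num.natAbs + Nat.size d.den) +
      ∑ i, B i := by
    rw [bitLength, ← hd, realBits_ratCast]
    congr 1
    refine Finset.sum_congr rfl fun i _ => ?_
    rw [← hlo, ← hhi, ← hva, ← hco]
    simp only [realBits_ratCast, B]
  have hED : ∏ i, E i ≤ 2 ^ ∑ i, (Nat.size (lo i).den + Nat.size (hi i).den +
      Nat.size (va i).den + Nat.size (co i).den) := by
    rw [← Finset.prod_pow_eq_pow_sum]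
    refine Finset.prod_le_prod' fun i _ => ?_
    simp only [E, pow_add]
    gcongr <;> exact (Nat.lt_size_self _).le
  have hDL : D ≤ 2 ^ I.bitLength := by
    refine (Nat.mul_le_mul (Nat.lt_size_self d.den).le hED).trans ?_
    rw [← pow_add]
    refine Nat.pow_le_pow_right two_pos ?_
    rw [hL]
    have : ∑ i, (Nat.size (lo i).den + Nat.size (hi i).den +
        Nat.size (va i).den + Nat.size (co i).den) ≤ ∑ i, B i :=
      Finset.sum_le_sum fun i _ => by simp only [B]; omega
    omega
  have frac : ∀ q : ℚ, q.den ∣ D → Nat.size q.num.natAbs ≤ I.bitLength →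
      IsFraction D (2 * I.bitLength + 1) (q : ℝ) := by
    rintro q ⟨e, he⟩ hq
    refine ⟨q.num * e, ?_, ?_⟩
    · have h₁ : (q : ℝ) * q.den = q.num := by exact_mod_cast Rat.mul_den_eq_num q
      rw [he]
      push_cast
      rw [← mul_assoc, h₁]
    · have h₁ : q.num.natAbs < 2 ^ I.bitLength := Nat.size_le.1 hq
      have h₂ : e ≤ 2 ^ I.bitLength :=
        (Nat.le_of_dvd hD (Dvd.intro_left _ he.symm)).trans hDL
      rw [Int.natAbs_mul, Int.natAbs_natCast]
      calc q.num.natAbs * e ≤ 2 ^ I.bitLength * 2 ^ I.bitLength := Nat.mul_le_mul h₁.le h₂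
        _ = 2 ^ (2 * I.bitLength) := by rw [← pow_add, two_mul]
        _ < _ := Nat.pow_lt_pow_right one_lt_two (by omega)
  have zero : IsFraction D (2 * I.bitLength + 1) 0 := ⟨0, by simp, by simp⟩
  have hEi : ∀ i, E i ∣ D := fun i => (Finset.dvd_prod_of_mem E (Finset.mem_univ i)).mul_left _
  have size_le : ∀ i, B i ≤ I.bitLength := fun i => by
    rw [hL]
    exact (Finset.single_le_sum (f := B) (fun _ _ => Nat.zero_le _)
        (Finset.mem_univ i)).trans (Nat.le_add_left _ _)
  refine ⟨D, hD, hDL.trans_lt (Nat.pow_lt_pow_right one_lt_two (by omega)), ⟨fun a k => ?_, ?_⟩⟩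
  · have hn : n < 2 ^ n := Nat.lt_two_pow_self
    have : 2 ^ n ≤ 2 ^ (2 * I.bitLength + 1) := Nat.pow_le_pow_right two_pos (by omega)
    simp only [initialMemory]
    split_ifs
    · omega
    · positivity
  · have vec : ∀ (x : Fin n → ℝ), (∀ i, IsFraction D (2 * I.bitLength + 1) (x i)) →
        ∀ k, IsFraction D (2 * I.bitLength + 1) (loadVec x k) := fun x hx k => by
      unfold loadVec
      split_ifs
      · exact hx _
      · exact zero
    intro a k
    simp only [initialMemory]
    split
    · split_ifs
      · rw [← hd]
        exact frac d (Dvd.intro _ rfl) (by omega)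
      · exact zero
    · refine vec _ (fun i => ?_) k
      rw [← hlo]
      exact frac _ (dvd_trans ⟨(hi i).den * (va i).den * (co i).den, by simp only [E]; ring⟩
        (hEi i)) (by have := size_le i; simp only [B] at this; omega)
    · refine vec _ (fun i => ?_) k
      rw [← hhi]
      exact frac _ (dvd_trans ⟨(lo i).den * (va i).den * (co i).den, by simp only [E]; ring⟩
        (hEi i)) (by have := size_le i; simp only [B] at this; omega)
    · refine vec _ (fun i => ?_) k
      rw [← hva]
      exact frac _ (dvd_trans ⟨(lo i).den * (hi i).den * (co i).den, by simp only [E]; ring⟩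
        (hEi i)) (by have := size_le i; simp only [B] at this; omega)
    · refine vec _ (fun i => ?_) k
      rw [← hco]
      exact frac _ (dvd_trans ⟨(lo i).den * (hi i).den * (va i).den, by simp only [E]; ring⟩
        (hEi i)) (by have := size_le i; simp only [B] at this; omega)
    · exact zero

/-- A program that takes polynomial time has polynomial logarithmic cost. -/
theorem exists_cost_polynomial (P : Program) (p : Polynomial ℕ) :
    ∃ q : Polynomial ℕ, ∀ (n : ℕ) (I : Input n) (t c : ℕ) (m : Memory),
      Runs P I.initialMemory t c m → t ≤ p.eval n → I.IsRational → c ≤ q.eval I.bitLength := by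
  refine ⟨p * (2 * (2 * Polynomial.X + 1 + Polynomial.C P.constSize + p) + 1),
    fun n I t c m hP ht hI => ?_⟩
  obtain ⟨D, hD, hDs, hm⟩ := exists_initialMemory_boundedBy hI
  have hc := (hP.boundedBy_and_cost_le (s := 2 * I.bitLength + 1 + P.constSize) hD
    (hDs.trans_le (Nat.pow_le_pow_right two_pos (by omega))) (hm.mono (by omega)) (by omega)).2
  have hn : n ≤ I.bitLength := by unfold bitLength; omega
  have htp : t ≤ p.eval I.bitLength := by
    refine ht.trans ?_
    simp only [Polynomial.eval_eq_sum, Polynomial.sum]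
    gcongr
  refine hc.trans ?_
  simp only [Polynomial.eval_mul, Polynomial.eval_add, Polynomial.eval_C, Polynomial.eval_X,
    Polynomial.eval_one, Polynomial.eval_ofNat]
  gcongr

end Input

/-! ### Reasoning about programs -/

/-- The program, started with memory `m`, halts after at most `T` operations with a memory that
satisfies `Q`. -/
def Ensures (p : Program) (m : Memory) (T : ℕ) (Q : Memory → Prop) : Prop :=
  ∃ t c m', Runs p m t c m' ∧ t ≤ T ∧ Q m'

/-- The program has an assignment to the array `a` of natural numbers. -/
def Program.writesNat (a : ℕ) : Program → Bool
  | skip => false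
  | setNat b _ _ => b == a
  | setReal _ _ _ => false
  | seq p q => p.writesNat a || q.writesNat a
  | ifElse _ p q => p.writesNat a || q.writesNat a
  | .while _ p => p.writesNat a

/-- The program has an assignment to the array `a` of real numbers. -/
def Program.writesReal (a : ℕ) : Program → Bool
  | skip => false
  | setNat _ _ _ => false
  | setReal b _ _ => b == a
  | seq p q => p.writesReal a || q.writesReal a
  | ifElse _ p q => p.writesReal a || q.writesReal a
  | .while _ p => p.writesReal a

/-- The memories `m` and `m'` agree on all arrays to which `p` has no assignment. -/
structure Frame (p : Program) (m m' : Memory) : Prop where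
  nat_eq : ∀ a, p.writesNat a = false → m'.nat a = m.nat a
  real_eq : ∀ a, p.writesReal a = false → m'.real a = m.real a

theorem Frame.refl (p : Program) (m : Memory) : Frame p m m := ⟨fun _ _ => rfl, fun _ _ => rfl⟩

theorem Frame.trans {p : Program} {m m' m'' : Memory} (h : Frame p m m') (h' : Frame p m' m'') :
    Frame p m m'' :=
  ⟨fun a ha => (h'.nat_eq a ha).trans (h.nat_eq a ha),
    fun a ha => (h'.real_eq a ha).trans (h.real_eq a ha)⟩

theorem Frame.weaken {p q : Program} {m m' : Memory} (h : Frame p m m')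
    (hn : ∀ a, q.writesNat a = false → p.writesNat a = false)
    (hr : ∀ a, q.writesReal a = false → p.writesReal a = false) : Frame q m m' :=
  ⟨fun a ha => h.nat_eq a (hn a ha), fun a ha => h.real_eq a (hr a ha)⟩

@[simp] theorem Memory.setNat_nat (m : Memory) (a k v b l : ℕ) :
    (m.setNat a k v).nat b l = if b = a ∧ l = k then v else m.nat b l := rfl

@[simp] theorem Memory.setNat_real (m : Memory) (a k v : ℕ) :
    (m.setNat a k v).real = m.real := rfl

@[simp] theorem Memory.setReal_real (m : Memory) (a k : ℕ) (v : ℝ) (b l : ℕ) :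
    (m.setReal a k v).real b l = if b = a ∧ l = k then v else m.real b l := rfl

@[simp] theorem Memory.setReal_nat (m : Memory) (a k : ℕ) (v : ℝ) :
    (m.setReal a k v).nat = m.nat := rfl

theorem Runs.frame {p : Program} {m m' : Memory} {t c : ℕ} (h : Runs p m t c m') :
    Frame p m m' := by
  induction h with
  | skip m => exact Frame.refl _ _
  | setNat a k e m =>
    refine ⟨fun b hb => funext fun l => ?_, fun b _ => rfl⟩
    have : b ≠ a := by rintro rfl; simp [Program.writesNat] at hb
    simp [this]
  | setReal a k e m =>
    refine ⟨fun b _ => rfl, fun b hb => funext fun l => ?_⟩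
    have : b ≠ a := by rintro rfl; simp [Program.writesReal] at hb
    simp [this]
  | seq _ _ ih₁ ih₂ =>
    exact (ih₁.weaken (by simp +contextual [Program.writesNat])
      (by simp +contextual [Program.writesReal])).trans
      (ih₂.weaken (by simp +contextual [Program.writesNat])
      (by simp +contextual [Program.writesReal]))
  | ifTrue _ _ ih =>
    exact ih.weaken (by simp +contextual [Program.writesNat])
      (by simp +contextual [Program.writesReal])
  | ifFalse _ _ ih =>
    exact ih.weaken (by simp +contextual [Program.writesNat])
      (by simp +contextual [Program.writesReal])
  | whileFalse _ => exact Frame.refl _ _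
  | whileTrue _ _ _ ih₁ ih₂ =>
    exact (ih₁.weaken (by simp [Program.writesNat]) (by simp [Program.writesReal])).trans ih₂

theorem Ensures.mono {p : Program} {m : Memory} {T U : ℕ} {Q R : Memory → Prop}
    (h : Ensures p m T Q) (hT : T ≤ U) (hQ : ∀ m', Frame p m m' → Q m' → R m') :
    Ensures p m U R := by
  obtain ⟨t, c, m', hr, ht, hm⟩ := h
  exact ⟨t, c, m', hr, ht.trans hT, hQ m' hr.frame hm⟩

theorem ensures_skip {m : Memory} {T : ℕ} {Q : Memory → Prop} (h : Q m) (hT : 1 ≤ T) :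
    Ensures .skip m T Q := ⟨1, 1, m, .skip m, hT, h⟩

theorem ensures_setNat {a : ℕ} {k e : NatExp} {m : Memory} {T : ℕ} {Q : Memory → Prop}
    (h : Q (m.setNat a (k.eval m) (e.eval m))) (hT : k.time + e.time + 1 ≤ T) :
    Ensures (.setNat a k e) m T Q := ⟨_, _, _, .setNat a k e m, hT, h⟩

theorem ensures_setReal {a : ℕ} {k : NatExp} {e : RealExp} {m : Memory} {T : ℕ}
    {Q : Memory → Prop} (h : Q (m.setReal a (k.eval m) (e.eval m)))
    (hT : k.time + e.time + 1 ≤ T) : Ensures (.setReal a k e) m T Q :=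
  ⟨_, _, _, .setReal a k e m, hT, h⟩

theorem Ensures.seq {p q : Program} {m : Memory} {T U : ℕ} {Q R : Memory → Prop}
    (hp : Ensures p m T Q) (hq : ∀ m', Frame p m m' → Q m' → Ensures q m' U R) :
    Ensures (.seq p q) m (T + U) R := by
  obtain ⟨t, c, m', hr, ht, hm⟩ := hp
  obtain ⟨u, d, m'', hr', hu, hm'⟩ := hq m' hr.frame hm
  exact ⟨_, _, _, .seq hr hr', add_le_add ht hu, hm'⟩

theorem ensures_ifElse {b : Test} {p q : Program} {m : Memory} {T U : ℕ} {Q : Memory → Prop}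
    (hp : b.Holds m → Ensures p m T Q) (hq : ¬ b.Holds m → Ensures q m T Q)
    (hT : b.time + T ≤ U) : Ensures (.ifElse b p q) m U Q := by
  by_cases hb : b.Holds m
  · obtain ⟨t, c, m', hr, ht, hm⟩ := hp hb
    exact ⟨_, _, _, .ifTrue hb hr, by omega, hm⟩
  · obtain ⟨t, c, m', hr, ht, hm⟩ := hq hb
    exact ⟨_, _, _, .ifFalse hb hr, by omega, hm⟩

/-- The value of the counter `c`, which is kept in cell `0` of the array `c`. -/
def counter (c : ℕ) : NatExp := .read c (.const 0)

/-- Run `p` once for every value of the counter `c` that is less than the content of cell `0` of the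
array `0`. -/
def Program.loop (c : ℕ) (p : Program) : Program :=
  .seq (.setNat c (.const 0) (.const 0))
    (.while (.natLt (counter c) (counter 0))
      (.seq p (.setNat c (.const 0) (.add (counter c) (.const 1)))))

theorem ensures_loop {c : ℕ} {p : Program} {m₀ : Memory} {n T : ℕ} (Inv : ℕ → Memory → Prop)
    (h0 : p.writesNat 0 = false) (hcp : p.writesNat c = false) (hc : c ≠ 0)
    (hn : m₀.nat 0 0 = n) (init : Inv 0 (m₀.setNat c 0 0))
    (step : ∀ i < n, ∀ m, Frame (.loop c p) m₀ m → m.nat c 0 = i → Inv i m →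
      Ensures p m T fun m' => Inv (i + 1) (m'.setNat c 0 (i + 1))) :
    Ensures (.loop c p) m₀ (n * (T + 11) + 8) (Inv n) := by
  have hcb : (c == 0) = false := by simpa using hc
  have frame_p : ∀ m m', Frame p m m' → Frame (.loop c p) m m' := fun m m' h =>
    h.weaken (by simp +contextual [Program.loop, Program.writesNat])
      (by simp +contextual [Program.loop, Program.writesReal])
  have frame_c : ∀ (m : Memory) v, Frame (.loop c p) m (m.setNat c 0 v) := by
    refine fun m v => ⟨fun a ha => funext fun l => ?_, fun _ _ => rfl⟩
    have : a ≠ c := by rintro rfl; simp [Program.loop, Program.writesNat] at ha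
    simp [this]
  have frame_0 : ∀ m, Frame (.loop c p) m₀ m → m.nat 0 0 = n := fun m h => by
    rw [h.nat_eq 0 (by simp [Program.loop, Program.writesNat, h0, hcb]), hn]
  have main : ∀ k i m, i + k = n → Frame (.loop c p) m₀ m → m.nat c 0 = i → Inv i m →
      Ensures (.while (.natLt (counter c) (counter 0))
        (.seq p (.setNat c (.const 0) (.add (counter c) (.const 1))))) m (k * (T + 11) + 5)
        (Inv n) := by
    intro k
    induction k with
    | zero =>
      intro i m hi hf hm hI
      refine ⟨_, _, m, .whileFalse ?_, ?_, ?_⟩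
      · have := frame_0 m hf
        simp only [Test.Holds, counter, NatExp.eval]
        omega
      · simp [Test.time, counter, NatExp.time]
      · obtain rfl : i = n := hi
        exact hI
    | succ k ih =>
      intro i m hi hf hm hI
      obtain ⟨t, d, m', hr, ht, hI'⟩ := step i (by omega) m hf hm hI
      have hm' : m'.nat c 0 = i := by rw [hr.frame.nat_eq c hcp, hm]
      obtain ⟨u, e, m'', hr', hu, hI''⟩ := ih (i + 1) (m'.setNat c 0 (i + 1)) (by omega)
        ((hf.trans (frame_p _ _ hr.frame)).trans (frame_c _ _)) (by simp) hI'
      have hset := Runs.setNat c (.const 0) (.add (counter c) (.const 1)) m'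
      simp only [NatExp.eval, counter, hm'] at hset
      refine ⟨_, _, m'', .whileTrue ?_ (.seq hr hset) hr', ?_, hI''⟩
      · have := frame_0 m hf
        simp only [Test.Holds, counter, NatExp.eval]
        omega
      · simp only [Test.time, counter, NatExp.time]
        linarith
  refine Ensures.mono (T := 3 + (n * (T + 11) + 5)) (Q := Inv n) ?_ (by omega) fun _ _ h => h
  refine Ensures.seq (Q := fun m => m = m₀.setNat c 0 0) (ensures_setNat rfl le_rfl) ?_
  rintro _ - rfl
  exact main n 0 _ (by simp) (frame_c _ _) (by simp) init

/-! ### The program -/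

namespace Test

/-- The disjunction of two tests. -/
def or (b c : Test) : Test := .not (.and (.not b) (.not c))

/-- Two natural numbers are equal. -/
def natEq (e f : NatExp) : Test := .and (.not (.natLt e f)) (.not (.natLt f e))

/-- A real number is positive. -/
def realPos (e : RealExp) : Test := .realLt (.sub e e) e

@[simp] theorem holds_or {b c : Test} {m : Memory} : (or b c).Holds m ↔ b.Holds m ∨ c.Holds m := by
  simp only [or, Holds]; tauto

@[simp] theorem holds_natEq {e f : NatExp} {m : Memory} :
    (natEq e f).Holds m ↔ e.eval m = f.eval m := by
  simp only [natEq, Holds]; omega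

@[simp] theorem holds_realPos {e : RealExp} {m : Memory} :
    (realPos e).Holds m ↔ 0 < e.eval m := by
  simp [realPos, Holds, RealExp.eval]

end Test

/-- The error threshold. -/
def deltaExp : RealExp := .read 0 (.const 0)

/-- Item `i` forces the query of item `j`. -/
def forcesTest (i j : NatExp) : Test :=
  .and (.not (.natEq i j))
    (.and (.realLt (.read 1 j) (.sub (.read 3 i) deltaExp))
      (.realLt (.add (.read 3 i) deltaExp) (.read 2 j)))

/-- Item `j` belongs to the closed neighbourhood of item `i` in the dependency graph. -/
def nearTest (i j : NatExp) : Test :=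
  .or (.natEq i j)
    (.and (.realLt deltaExp (.sub (.read 2 i) (.read 1 j)))
      (.realLt deltaExp (.sub (.read 2 j) (.read 1 i))))

/-- Store the weights of the items in the array `5` of real numbers, and put all items into the
output set. -/
def initProgram : Program :=
  .loop 10 (.seq (.setReal 5 (counter 10) (.read 4 (counter 10)))
    (.seq (.setNat 1 (counter 10) (.const 1))
      (.loop 11 (.ifElse (forcesTest (counter 11) (counter 10))
        (.setReal 5 (counter 10) (.sub (.read 5 (counter 10)) (.read 5 (counter 10)))) .skip))))

/-- The item selected in the current round. The rounds are numbered by the counter `10`, and the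
array `5` of natural numbers holds the selected items. -/
def selectedExp : NatExp := .read 5 (counter 10)

/-- Select an item with the smallest right end among those with positive weight. -/
def selectProgram : Program :=
  .seq (.setNat 5 (counter 10) (.const 0))
    (.loop 11 (.ifElse
      (.and (.realPos (.read 5 (counter 11)))
        (.or (.not (.realPos (.read 5 selectedExp)))
          (.realLt (.read 2 (counter 11)) (.read 2 selectedExp))))
      (.setNat 5 (counter 10) (counter 11)) .skip))

/-- Lower the weights in the closed neighbourhood of the selected item by its weight if that is
positive. The weight is kept in the array `6`. -/
def lowerProgram : Program :=
  .seq (.setReal 6 (counter 10) (.read 5 selectedExp))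
    (.loop 11 (.ifElse
      (.and (.realPos (.read 6 (counter 10))) (nearTest selectedExp (counter 11)))
      (.setReal 5 (counter 11) (.sub (.read 5 (counter 11)) (.read 6 (counter 10)))) .skip))

/-- The round that is treated when the rounds are gone through in reverse order. -/
def roundExp : NatExp := .sub (counter 0) (.add (counter 10) (.const 1))

/-- The item selected in that round. -/
def candidateExp : NatExp := .read 5 roundExp

/-- Remove the candidate from the output set unless it had no positive weight when it was selected
or one of its neighbours has been removed before. Cell `0` of the array `6` of natural numbers
records whether such a neighbour has been found. -/
def insertProgram : Program :=
  .seq (.setNat 6 (.const 0) (.const 0))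
    (.seq (.loop 11 (.ifElse
        (.and (.not (.natLt (.const 0) (.read 1 (counter 11))))
          (nearTest candidateExp (counter 11)))
        (.setNat 6 (.const 0) (.const 1)) .skip))
      (.ifElse (.and (.realPos (.read 6 roundExp)) (.not (.natLt (.const 0) (counter 6))))
        (.setNat 1 candidateExp (.const 0)) .skip))

/-- Compute the weights, run `n` rounds of selecting an item and lowering weights, and go through
the selected items in reverse order. -/
def queryProgram : Program :=
  .seq initProgram (.seq (.loop 10 (.seq selectProgram lowerProgram)) (.loop 10 insertProgram))

/-! ### Correctness of the program -/

/-- The memory holds the instance `I`. -/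
structure HasInput {n : ℕ} (I : Input n) (m : Memory) : Prop where
  size : m.nat 0 0 = n
  delta : m.real 0 0 = I.delta
  lo : ∀ i : Fin n, m.real 1 i = I.lo i
  hi : ∀ i : Fin n, m.real 2 i = I.hi i
  val : ∀ i : Fin n, m.real 3 i = I.val i
  cost : ∀ i : Fin n, m.real 4 i = I.cost i

/-- The program has no assignments to the arrays that hold the instance. -/
def Program.keepsInput (p : Program) : Bool :=
  !p.writesNat 0 && !p.writesReal 0 && !p.writesReal 1 && !p.writesReal 2 && !p.writesReal 3 &&
    !p.writesReal 4

section Correctness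

variable {n : ℕ} {I : Input n} {m : Memory}

theorem hasInput_initialMemory (I : Input n) : HasInput I I.initialMemory := by
  constructor <;> simp [Input.initialMemory, loadVec]

theorem HasInput.frame {p : Program} {m' : Memory} (h : HasInput I m) (hf : Frame p m m')
    (hp : p.keepsInput = true) : HasInput I m' := by
  simp only [Program.keepsInput, Bool.and_eq_true, Bool.not_eq_true'] at hp
  obtain ⟨⟨⟨⟨⟨h₀, h₁⟩, h₂⟩, h₃⟩, h₄⟩, h₅⟩ := hp
  constructor
  · rw [hf.nat_eq 0 h₀, h.size]
  · rw [hf.real_eq 0 h₁, h.delta]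
  · rw [hf.real_eq 1 h₂]; exact h.lo
  · rw [hf.real_eq 2 h₃]; exact h.hi
  · rw [hf.real_eq 3 h₄]; exact h.val
  · rw [hf.real_eq 4 h₅]; exact h.cost

theorem holds_forcesTest (h : HasInput I m) {e f : NatExp} {i j : Fin n} (he : e.eval m = i)
    (hf : f.eval m = j) : (forcesTest e f).Holds m ↔
      i ≠ j ∧ I.lo j < I.val i - I.delta ∧ I.val i + I.delta < I.hi j := by
  simp [forcesTest, deltaExp, Test.Holds, RealExp.eval, NatExp.eval, he, hf, h.lo, h.hi, h.val,
    h.delta, Fin.ext_iff]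

theorem holds_nearTest (h : HasInput I m) {e f : NatExp} {i j : Fin n} (he : e.eval m = i)
    (hf : f.eval m = j) : (nearTest e f).Holds m ↔ Near I.depGraph i j := by
  simp only [nearTest, deltaExp, Test.holds_or, Test.holds_natEq, Test.Holds, RealExp.eval,
    NatExp.eval, he, hf, h.lo, h.hi, h.delta, ← Fin.ext_iff, Near, Input.depGraph]
  tauto

theorem ensures_initProgram (h : HasInput I m) :
    Ensures initProgram m (n * (n * 111 + 119) + 8) fun m' =>
      ∀ j : Fin n, m'.real 5 j = I.weight j ∧ m'.nat 1 j = 1 := by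
  classical
  refine (ensures_loop (n := n) (T := 100 + (n * (100 + 11) + 8))
    (fun i m' => ∀ j : Fin n, (j : ℕ) < i → m'.real 5 j = I.weight j ∧ m'.nat 1 j = 1)
    rfl rfl (by decide) h.size (by simp) ?_).mono (by ring_nf; omega)
    fun m' _ hm j => hm j j.2
  intro i hi m₁ hf₁ hc₁ hm₁
  have h₁ := h.frame hf₁ rfl
  refine Ensures.mono (T := 50 + (50 + (n * (100 + 11) + 8)))
    (Q := fun m' => (m'.real 5 i = I.weight ⟨i, hi⟩ ∧ m'.nat 1 i = 1) ∧
      ∀ j : Fin n, (j : ℕ) < i → m'.real 5 j = m₁.real 5 j ∧ m'.nat 1 j = m₁.nat 1 j) ?_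
    (by omega) ?_
  · refine Ensures.seq (Q := fun m' => m'.real 5 i = I.cost ⟨i, hi⟩ ∧
      ∀ j, j < i → m'.real 5 j = m₁.real 5 j) (ensures_setReal ?_ (by decide)) ?_
    · have hcost := h₁.cost ⟨i, hi⟩
      simp only [counter, NatExp.eval, RealExp.eval, hc₁] at *
      refine ⟨by simpa using hcost, fun j hj => by simp [hj.ne]⟩
    intro m₂ hf₂ hm₂
    have hc₂ : m₂.nat 10 0 = i := by rw [hf₂.nat_eq 10 rfl, hc₁]
    refine Ensures.seq (Q := fun m' => m' = m₂.setNat 1 i 1)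
      (ensures_setNat (by simp [counter, NatExp.eval, hc₂]) (by decide)) ?_
    rintro _ hf₃ rfl
    have h₃ := (h₁.frame hf₂ rfl).frame hf₃ rfl
    refine (ensures_loop (n := n) (T := 100)
      (fun l m' => (m'.real 5 i = if ∃ l' : Fin n, (l' : ℕ) < l ∧ l' ≠ ⟨i, hi⟩ ∧
        I.lo ⟨i, hi⟩ < I.val l' - I.delta ∧ I.val l' + I.delta < I.hi ⟨i, hi⟩ then 0
        else I.cost ⟨i, hi⟩) ∧ ∀ j, j < i → m'.real 5 j = m₁.real 5 j)
      rfl rfl (by decide) h₃.size ?_ ?_).mono le_rfl ?_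
    · simpa using hm₂
    · intro l hl m₄ hf₄ hc₄ hm₄
      have h₄ := h₃.frame hf₄ rfl
      have hi₄ : m₄.nat 10 0 = i := by
        rw [hf₄.nat_eq 10 rfl]; simp [hc₂]
      have iff := holds_forcesTest h₄ (e := counter 11) (f := counter 10) (i := ⟨l, hl⟩)
        (j := ⟨i, hi⟩) hc₄ hi₄
      refine ensures_ifElse (T := 20) (fun ht => ensures_setReal ?_ (by decide))
        (fun ht => ensures_skip ?_ (by decide)) (by decide)
      · rw [iff] at ht
        simp only [counter, NatExp.eval, RealExp.eval, hi₄, Memory.setNat_real,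
          Memory.setReal_real, sub_self, true_and, if_true]
        refine ⟨(if_pos ⟨⟨l, hl⟩, Nat.lt_succ_self _, ht⟩).symm, fun j hj => ?_⟩
        rw [if_neg hj.ne, hm₄.2 j hj]
      · rw [iff] at ht
        refine ⟨?_, hm₄.2⟩
        simp only [Memory.setNat_real, hm₄.1]
        refine if_congr ⟨fun ⟨l', hl', h'⟩ => ⟨l', Nat.lt_succ_of_lt hl', h'⟩,
          fun ⟨l', hl', h'⟩ => ⟨l', ?_, h'⟩⟩ rfl rfl
        refine lt_of_le_of_ne (Nat.le_of_lt_succ hl') fun he => ht ?_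
        obtain rfl : l' = ⟨l, hl⟩ := Fin.ext he
        exact h'
    · intro m₅ hf₅ hm₅
      have h1 : m₅.nat 1 = (m₂.setNat 1 i 1).nat 1 := hf₅.nat_eq 1 rfl
      refine ⟨⟨?_, by simp [h1]⟩, fun j hj => ⟨hm₅.2 j hj, ?_⟩⟩
      · rw [hm₅.1, Input.weight]
        refine if_congr ?_ rfl rfl
        rw [I.mem_forced]
        exact ⟨fun ⟨l', _, h'⟩ => ⟨l', h'⟩, fun ⟨l', h'⟩ => ⟨l', l'.2, h'⟩⟩
      · simp [h1, hj.ne, hf₂.nat_eq 1 rfl]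
  · intro m' _ hm' j hj
    simp only [Memory.setNat_real, Memory.setNat_nat]
    rcases Nat.lt_succ_iff_lt_or_eq.1 hj with hj | hj
    · simpa [hm'.2 j hj] using hm₁ j hj
    · obtain rfl : j = ⟨i, hi⟩ := Fin.ext hj
      simpa using hm'.1

/-- The item `b` has the smallest right end among the items of positive weight. -/
def IsSelection (I : Input n) (w : Fin n → ℝ) (b : Fin n) : Prop :=
  ∀ i, 0 < w i → 0 < w b ∧ I.hi b ≤ I.hi i

theorem ensures_selectProgram (h : HasInput I m) {k : ℕ} (hk : k < n) (hc : m.nat 10 0 = k) :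
    Ensures selectProgram m (n * 111 + 50) fun m' =>
      (∃ b : Fin n, m'.nat 5 k = b ∧ IsSelection I (fun i => m.real 5 i) b) ∧
        ∀ l, l ≠ k → m'.nat 5 l = m.nat 5 l := by
  refine Ensures.mono (T := 40 + (n * (100 + 11) + 8)) ?_ (by omega) fun _ _ h => h
  refine Ensures.seq (Q := fun m' => m' = m.setNat 5 k 0)
    (ensures_setNat (by simp [counter, NatExp.eval, hc]) (by decide)) ?_
  rintro _ hf rfl
  have h₁ := h.frame hf rfl
  refine (ensures_loop (n := n) (T := 100)
    (fun l m' => (∃ b : Fin n, m'.nat 5 k = b ∧ ∀ i : Fin n, (i : ℕ) < l → 0 < m.real 5 i →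
      0 < m.real 5 b ∧ I.hi b ≤ I.hi i) ∧ ∀ l, l ≠ k → m'.nat 5 l = m.nat 5 l)
    rfl rfl (by decide) h₁.size ?_ ?_).mono le_rfl ?_
  · exact ⟨⟨⟨0, by omega⟩, by simp, by simp⟩, fun l hl => by simp [hl]⟩
  · rintro l hl m₂ hf₂ hc₂ ⟨⟨b, hb, hsel⟩, hm₂⟩
    have h₂ := h₁.frame hf₂ rfl
    have hk₂ : m₂.nat 10 0 = k := by rw [hf₂.nat_eq 10 rfl]; simp [hc]
    have hw : m₂.real 5 = m.real 5 := hf₂.real_eq 5 rfl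
    have hl' : m₂.real 2 l = I.hi ⟨l, hl⟩ := h₂.hi ⟨l, hl⟩
    refine ensures_ifElse (T := 20) (fun ht => ensures_setNat ?_ (by decide))
      (fun ht => ensures_skip ?_ (by decide)) (by decide)
    all_goals
      simp only [selectedExp, counter, Test.Holds, Test.holds_or, Test.holds_realPos, NatExp.eval,
        RealExp.eval, hc₂, hk₂, hb, hw, h₂.hi, hl'] at ht
    · simp only [counter, NatExp.eval, hc₂, hk₂]
      refine ⟨⟨⟨l, hl⟩, by simp, fun i hi hpos => ⟨ht.1, ?_⟩⟩, fun l hl => by simp [hl, hm₂]⟩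
      rcases Nat.lt_succ_iff_lt_or_eq.1 hi with hi | hi
      · obtain ⟨h₃, h₄⟩ := hsel i hi hpos
        rcases ht.2 with h₅ | h₅
        · exact absurd h₃ h₅
        · exact h₅.le.trans h₄
      · obtain rfl : i = ⟨l, hl⟩ := Fin.ext hi
        exact le_rfl
    · refine ⟨⟨b, by simp [hb], fun i hi hpos => ?_⟩, fun l hl => by simp [hm₂ l hl]⟩
      rcases Nat.lt_succ_iff_lt_or_eq.1 hi with hi | hi
      · exact hsel i hi hpos
      · obtain rfl : i = ⟨l, hl⟩ := Fin.ext hi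
        have := not_and.1 ht hpos
        push Not at this
        exact this
  · rintro m' - ⟨⟨b, hb, hsel⟩, hm'⟩
    exact ⟨⟨b, hb, fun i => hsel i i.2⟩, hm'⟩

theorem ensures_lowerProgram (h : HasInput I m) {k : ℕ} {b : Fin n} (hc : m.nat 10 0 = k)
    (hb : m.nat 5 k = b) :
    Ensures lowerProgram m (n * 111 + 50) fun m' =>
      m'.real 6 k = m.real 5 b ∧ (∀ l, l ≠ k → m'.real 6 l = m.real 6 l) ∧
        (fun i : Fin n => m'.real 5 i) = if 0 < m.real 5 b then
          lower I.depGraph (fun i => m.real 5 i) b else fun i => m.real 5 i := by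
  classical
  refine Ensures.mono (T := 40 + (n * (100 + 11) + 8)) ?_ (by omega) fun _ _ h => h
  refine Ensures.seq (Q := fun m' => m' = m.setReal 6 k (m.real 5 b))
    (ensures_setReal (by simp [selectedExp, counter, NatExp.eval, RealExp.eval, hc, hb])
      (by decide)) ?_
  rintro _ hf rfl
  have h₁ := h.frame hf rfl
  refine (ensures_loop (n := n) (T := 100)
    (fun l m' => ∀ i : Fin n, m'.real 5 i =
      if (i : ℕ) < l ∧ 0 < m.real 5 b ∧ Near I.depGraph b i then m.real 5 i - m.real 5 b
      else m.real 5 i)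
    rfl rfl (by decide) h₁.size (by simp) ?_).mono le_rfl ?_
  · intro l hl m₂ hf₂ hc₂ hm₂
    have h₂ := h₁.frame hf₂ rfl
    have hk₂ : m₂.nat 10 0 = k := by rw [hf₂.nat_eq 10 rfl]; simp [hc]
    have hb₂ : m₂.nat 5 k = b := by rw [hf₂.nat_eq 5 rfl]; simp [hb]
    have hlam : m₂.real 6 k = m.real 5 b := by rw [hf₂.real_eq 6 rfl]; simp
    have near := holds_nearTest h₂ (e := selectedExp) (f := counter 11) (i := b) (j := ⟨l, hl⟩)
      (by simp [selectedExp, counter, NatExp.eval, hk₂, hb₂]) hc₂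
    have hl' := hm₂ ⟨l, hl⟩
    simp only [lt_irrefl, false_and, if_false] at hl'
    refine ensures_ifElse (T := 20) (fun ht => ensures_setReal ?_ (by decide))
      (fun ht => ensures_skip ?_ (by decide)) (by decide)
    all_goals
      simp only [counter, Test.Holds, Test.holds_realPos, NatExp.eval,
        RealExp.eval, hk₂, hlam] at ht
      simp only [counter] at near
      rw [near] at ht
      intro i
      simp only [counter, NatExp.eval, RealExp.eval, hc₂, hk₂, hlam, hl', Memory.setNat_real,
        Memory.setReal_real, true_and]
    · by_cases hil : (i : ℕ) = l
      · obtain rfl : i = ⟨l, hl⟩ := Fin.ext hil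
        rw [if_pos rfl, if_pos ⟨Nat.lt_succ_self l, ht⟩]
      · rw [if_neg hil, hm₂]
        refine if_congr (and_congr_left fun _ => ?_) rfl rfl
        omega
    · rw [hm₂]
      by_cases hil : (i : ℕ) = l
      · obtain rfl : i = ⟨l, hl⟩ := Fin.ext hil
        rw [if_neg (fun h => lt_irrefl _ h.1), if_neg (fun h => ht h.2)]
      · refine if_congr (and_congr_left fun _ => ?_) rfl rfl
        omega
  · intro m₃ hf₃ hm₃
    have h6 := hf₃.real_eq 6 rfl
    refine ⟨by simp [h6], fun l hl => by simp [h6, hl], funext fun i => ?_⟩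
    rw [hm₃ i]
    by_cases hpos : 0 < m.real 5 b <;> simp [hpos, lower]

/-- Undo the rounds `k - 1, …, 0`, in which the items `b` with weights `w` were selected: each of
these items is inserted into `S` by `insertIfFree` if its weight was positive. -/
noncomputable def unwind (G : SimpleGraph (Fin n)) (b : ℕ → ℕ) (w : ℕ → ℝ) :
    ℕ → Finset (Fin n) → Finset (Fin n)
  | 0, S => S
  | k + 1, S => unwind G b w k
      (open Classical in if h : 0 < w k ∧ b k < n then insertIfFree G ⟨b k, h.2⟩ S else S)

theorem unwind_congr {G : SimpleGraph (Fin n)} {b b' : ℕ → ℕ} {w w' : ℕ → ℝ} {k : ℕ}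
    (hb : ∀ l < k, b l = b' l) (hw : ∀ l < k, w l = w' l) (S : Finset (Fin n)) :
    unwind G b w k S = unwind G b' w' k S := by
  induction k generalizing S with
  | zero => rfl
  | succ k ih =>
    simp only [unwind, hb k (Nat.lt_succ_self k), hw k (Nat.lt_succ_self k)]
    exact ih (fun l hl => hb l (Nat.lt_succ_of_lt hl)) (fun l hl => hw l (Nat.lt_succ_of_lt hl)) _

/-- After `n` rounds no positive weight is left, and undoing the rounds turns the empty set into an
independent set of maximum weight. -/
theorem ensures_selection_rounds (h : HasInput I m)
    (hw : ∀ j : Fin n, m.real 5 j = I.weight j) :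
    Ensures (.loop 10 (.seq selectProgram lowerProgram)) m (n * (n * 222 + 111) + 8) fun m' =>
      IsMaxWeightIndepSet I.depGraph I.weight (unwind I.depGraph (m'.nat 5) (m'.real 6) n ∅) ∧
        ∀ k < n, m'.nat 5 k < n := by
  classical
  -- Every round with a positive weight left reduces the number of positive weights, so `n` rounds
  -- exhaust them; rounds without a positive weight change nothing.
  refine (ensures_loop (n := n) (T := (n * 111 + 50) + (n * 111 + 50))
    (fun k m' => (∀ S, IsMaxWeightIndepSet I.depGraph (fun j : Fin n => m'.real 5 j) S →
        IsMaxWeightIndepSet I.depGraph I.weight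
          (unwind I.depGraph (m'.nat 5) (m'.real 6) k S)) ∧
      #{j : Fin n | 0 < m'.real 5 j} ≤ n - k ∧ ∀ l < k, m'.nat 5 l < n)
    rfl rfl (by decide) h.size ?_ ?_).mono (by ring_nf; omega) ?_
  · refine ⟨fun S hS => ?_, ?_, by simp⟩
    · simpa [unwind, hw] using hS
    · exact (Finset.card_le_univ _).trans (by simp)
  · rintro k hk m₁ hf₁ hc₁ ⟨hmax, hcard, hlt⟩
    have h₁ := h.frame hf₁ rfl
    refine (ensures_selectProgram h₁ hk hc₁).seq ?_
    rintro m₂ hf₂ ⟨⟨b, hb, hsel⟩, hne⟩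
    have h₂ := h₁.frame hf₂ rfl
    have hw₂ : m₂.real 5 = m₁.real 5 := hf₂.real_eq 5 rfl
    have hlam₂ : m₂.real 6 = m₁.real 6 := hf₂.real_eq 6 rfl
    refine (ensures_lowerProgram h₂ (by rw [hf₂.nat_eq 10 rfl, hc₁]) hb).mono le_rfl ?_
    rintro m₃ hf₃ ⟨hlam, hlam', hw₃⟩
    have hb₃ : m₃.nat 5 = m₂.nat 5 := hf₃.nat_eq 5 rfl
    rw [hw₂] at hw₃ hlam
    have hset : (m₃.setNat 10 0 (k + 1)).nat 5 = m₂.nat 5 := by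
      funext l; simp [hb₃]
    rw [hset, Memory.setNat_real, hw₃]
    refine ⟨fun S hS => ?_, ?_, fun l hl => ?_⟩
    · have hunwind : ∀ S, unwind I.depGraph (m₂.nat 5) (m₃.real 6) k S =
          unwind I.depGraph (m₁.nat 5) (m₁.real 6) k S := fun S =>
        unwind_congr (fun l hl => hne l hl.ne)
          (fun l hl => by rw [hlam' l hl.ne, hlam₂]) S
      rw [unwind, hunwind]
      refine hmax _ ?_
      simp only [hb, hlam, Fin.is_lt, and_true, Fin.eta]
      by_cases hpos : 0 < m₁.real 5 b
      · rw [if_pos hpos] at hS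
        rw [dif_pos hpos]
        -- The vertices of positive weight near `b` form a clique since `b` has the smallest right
        -- end among the vertices of positive weight.
        refine hS.insertIfFree hpos fun i j hi hj hbi hbj hij => ?_
        rcases hbi with rfl | hbi <;> rcases hbj with rfl | hbj
        · exact absurd rfl hij
        · exact hbj
        · exact hbi.symm
        · exact I.depGraph_adj_of_hi_le (hsel i hi).2 (hsel j hj).2 hbi hbj hij
      · rw [if_neg hpos] at hS
        rw [dif_neg hpos]
        exact hS
    · have hcard' : #{j : Fin n | 0 < m₃.real 5 j} ≤ n - (k + 1) := by
        have hval : ∀ j : Fin n, m₃.real 5 j = _ := fun j => congrFun hw₃ j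
        simp only [hval]
        by_cases hpos : 0 < m₁.real 5 b
        · simp only [if_pos hpos]
          have hss : ({j : Fin n | 0 < lower I.depGraph (fun i => m₁.real 5 i) b j} :
              Finset (Fin n)) ⊂ ({j : Fin n | 0 < m₁.real 5 j} : Finset (Fin n)) := by
            refine Finset.ssubset_iff_subset_ne.2 ⟨fun j hj => ?_, fun he => ?_⟩
            · rw [Finset.mem_filter] at hj ⊢
              exact ⟨hj.1, hj.2.trans_le (lower_le (w := fun i : Fin n => m₁.real 5 i) hpos.le j)⟩
            · have hbm : b ∈ ({j : Fin n | 0 < m₁.real 5 j} : Finset (Fin n)) := by simp [hpos]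
              rw [← he] at hbm
              simp [lower_self] at hbm
          have := Finset.card_lt_card hss
          omega
        · have : ({j : Fin n | 0 < m₁.real 5 j} : Finset (Fin n)) = ∅ :=
            Finset.filter_eq_empty_iff.2 fun j _ hj => hpos (hsel j hj).1
          simp [if_neg hpos, this]
      exact hcard'
    · rcases Nat.lt_succ_iff_lt_or_eq.1 hl with hl | rfl
      · rw [hne l hl.ne]; exact hlt l hl
      · rw [hb]; exact b.2
  · rintro m' - ⟨hmax, hcard, hlt⟩
    refine ⟨hmax ∅ (isMaxWeightIndepSet_empty fun v => ?_), hlt⟩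
    rw [Nat.sub_self, Nat.le_zero, Finset.card_eq_zero] at hcard
    exact not_lt.1 (Finset.filter_eq_empty_iff.1 hcard (Finset.mem_univ v))

theorem mem_compl_outputSet {j : Fin n} : j ∈ (outputSet n m)ᶜ ↔ m.nat 1 j = 0 := by
  simp [outputSet]

theorem ensures_insertProgram (h : HasInput I m) {k : ℕ} {b : Fin n}
    (hc : m.nat 10 0 = k) (hb : m.nat 5 (n - (k + 1)) = b) :
    Ensures insertProgram m (n * 111 + 90) fun m' =>
      (outputSet n m')ᶜ = open Classical in if 0 < m.real 6 (n - (k + 1)) then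
        insertIfFree I.depGraph b (outputSet n m)ᶜ else (outputSet n m)ᶜ := by
  classical
  refine Ensures.mono (T := 20 + ((n * (100 + 11) + 8) + 60)) ?_ (by omega) fun _ _ h => h
  refine Ensures.seq (Q := fun m' => m' = m.setNat 6 0 0)
    (ensures_setNat rfl (by decide)) ?_
  rintro _ hf rfl
  have h₁ := h.frame hf rfl
  refine (ensures_loop (n := n) (T := 100)
    (fun l m' => 0 < m'.nat 6 0 ↔
      ∃ i : Fin n, (i : ℕ) < l ∧ m.nat 1 i = 0 ∧ Near I.depGraph b i)
    rfl rfl (by decide) h₁.size (by simp) ?_).seq ?_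
  · intro l hl m₂ hf₂ hc₂ hm₂
    have h₂ := h₁.frame hf₂ rfl
    have hk₂ : m₂.nat 10 0 = k := by rw [hf₂.nat_eq 10 rfl]; simp [hc]
    have hb₂ : m₂.nat 5 (n - (k + 1)) = b := by rw [hf₂.nat_eq 5 rfl]; simp [hb]
    have ho₂ : m₂.nat 1 l = m.nat 1 l := by rw [hf₂.nat_eq 1 rfl]; simp
    have near := holds_nearTest h₂ (e := candidateExp) (f := counter 11) (i := b) (j := ⟨l, hl⟩)
      (by simp [candidateExp, roundExp, counter, NatExp.eval, hk₂, hb₂, h₂.size]) hc₂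
    refine ensures_ifElse (T := 20) (fun ht => ensures_setNat ?_ (by decide))
      (fun ht => ensures_skip ?_ (by decide)) (by decide)
    all_goals
      rw [Test.Holds, near] at ht
      simp only [counter, Test.Holds, NatExp.eval, hc₂, ho₂, not_lt, Nat.le_zero] at ht
    · simp only [NatExp.eval, Memory.setNat_nat]
      norm_num
      exact ⟨⟨l, hl⟩, le_rfl, ht⟩
    · simp only [Memory.setNat_nat]
      norm_num
      rw [hm₂]
      refine ⟨fun ⟨i, hi, h'⟩ => ⟨i, hi.le, h'⟩, fun ⟨i, hi, h'⟩ => ⟨i, ?_, h'⟩⟩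
      refine lt_of_le_of_ne hi fun he => ht ?_
      obtain rfl : i = ⟨l, hl⟩ := Fin.ext he
      exact h'
  · intro m₃ hf₃ hm₃
    have h₃ := h₁.frame hf₃ rfl
    have hk₃ : m₃.nat 10 0 = k := by rw [hf₃.nat_eq 10 rfl]; simp [hc]
    have hb₃ : m₃.nat 5 (n - (k + 1)) = b := by rw [hf₃.nat_eq 5 rfl]; simp [hb]
    have ho₃ : ∀ l, m₃.nat 1 l = m.nat 1 l := by rw [hf₃.nat_eq 1 rfl]; simp
    have hlam₃ : m₃.real 6 = m.real 6 := hf₃.real_eq 6 rfl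
    have hm₃' : 0 < m₃.nat 6 0 ↔ ∃ s ∈ (outputSet n m)ᶜ, Near I.depGraph b s := by
      rw [hm₃]
      simp only [mem_compl_outputSet, Fin.is_lt, true_and]
    refine ensures_ifElse (T := 20) (fun ht => ensures_setNat ?_ (by decide))
      (fun ht => ensures_skip ?_ (by decide)) (by decide)
    all_goals
      simp only [Test.Holds, Test.holds_realPos, roundExp, counter, NatExp.eval, RealExp.eval,
        h₃.size, hk₃, hlam₃, hm₃'] at ht
    · rw [if_pos ht.1, insertIfFree, if_neg ht.2]
      ext j
      simp only [mem_compl_outputSet, Finset.mem_insert, candidateExp, roundExp, counter,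
        NatExp.eval, h₃.size, hk₃, hb₃, Memory.setNat_nat, true_and, ho₃, ← Fin.ext_iff]
      split_ifs with hj <;> simp [hj]
    · have : (outputSet n m₃)ᶜ = (outputSet n m)ᶜ := by
        ext j; simp only [mem_compl_outputSet, ho₃]
      rw [this]
      split_ifs with hpos
      · rw [insertIfFree, if_pos]
        by_contra hc
        exact ht ⟨hpos, hc⟩
      · rfl

theorem ensures_unwinding (h : HasInput I m) (hout : ∀ j : Fin n, m.nat 1 j = 1)
    (hlt : ∀ k < n, m.nat 5 k < n) :
    Ensures (.loop 10 insertProgram) m (n * (n * 111 + 101) + 8) fun m' =>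
      (outputSet n m')ᶜ = unwind I.depGraph (m.nat 5) (m.real 6) n ∅ := by
  classical
  -- The items that are not in the output set form the independent set under construction.
  refine (ensures_loop (n := n) (T := n * 111 + 90)
    (fun k m' => unwind I.depGraph (m.nat 5) (m.real 6) (n - k) (outputSet n m')ᶜ =
      unwind I.depGraph (m.nat 5) (m.real 6) n ∅)
    rfl rfl (by decide) h.size ?_ ?_).mono le_rfl ?_
  · have : (outputSet n (m.setNat 10 0 0))ᶜ = ∅ := by
      ext j
      simp only [mem_compl_outputSet, Memory.setNat_nat, hout]
      simp
    rw [this, Nat.sub_zero]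
  · intro k hk m₁ hf₁ hc₁ hm₁
    have h₁ := h.frame hf₁ rfl
    have h5 : m₁.nat 5 = m.nat 5 := hf₁.nat_eq 5 rfl
    have h6 : m₁.real 6 = m.real 6 := hf₁.real_eq 6 rfl
    have hb := hlt (n - (k + 1)) (by omega)
    refine (ensures_insertProgram h₁ hc₁ (b := ⟨m.nat 5 (n - (k + 1)), hb⟩)
      (by rw [h5])).mono le_rfl ?_
    intro m₂ _ hm₂
    have : (outputSet n (m₂.setNat 10 0 (k + 1)))ᶜ = (outputSet n m₂)ᶜ := by
      ext j
      simp only [mem_compl_outputSet, Memory.setNat_nat]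
      simp
    rw [this, hm₂, h6, ← hm₁, show n - k = n - (k + 1) + 1 by omega, unwind]
    congr 1
    by_cases hpos : 0 < m.real 6 (n - (k + 1))
    · rw [if_pos hpos, dif_pos ⟨hpos, hb⟩]
    · rw [if_neg hpos, dif_neg fun h => hpos h.1]
  · intro m' _ hm'
    simpa [unwind] using hm'

theorem ensures_queryProgram (I : Input n) :
    Ensures queryProgram I.initialMemory (1000 * (n + 1) ^ 2) fun m =>
      IsMaxWeightIndepSet I.depGraph I.weight (outputSet n m)ᶜ := by
  have h := hasInput_initialMemory I
  refine Ensures.mono (T := (n * (n * 111 + 119) + 8) + ((n * (n * 222 + 111) + 8) +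
    (n * (n * 111 + 101) + 8))) ?_ (by nlinarith) fun _ _ h => h
  refine (ensures_initProgram h).seq fun m₁ hf₁ hm₁ => ?_
  have h₁ := h.frame hf₁ rfl
  refine (ensures_selection_rounds h₁ fun j => (hm₁ j).1).seq fun m₂ hf₂ hm₂ => ?_
  refine (ensures_unwinding (h₁.frame hf₂ rfl) (fun j => ?_) hm₂.2).mono le_rfl
    fun m₃ _ hm₃ => ?_
  · rw [hf₂.nat_eq 1 rfl, (hm₁ j).2]
  · rw [hm₃]
    exact hm₂.1

end Correctness

end QuerySort

theorem mainTheorem10 :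
    ∃ (P : QuerySort.Program) (p q : Polynomial ℕ),
      ∀ (n : ℕ) (I : QuerySort.Input n),
        ∃ (t c : ℕ) (m : QuerySort.Memory),
          QuerySort.Runs P I.initialMemory t c m ∧
          t ≤ p.eval n ∧
          (I.IsRational → c ≤ q.eval I.bitLength) ∧
          I.IsOptimumQuerySet (QuerySort.outputSet n m) ∧
          (∃ C : Finset {i : Fin n // i ∉ I.forced},
            QuerySort.outputSet n m = I.forced ∪ C.map (Function.Embedding.subtype _) ∧
            QuerySort.IsMinWeightVertexCover I.remainingGraph (fun i => I.cost i) C) ∧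
          QuerySort.IsChordal I.remainingGraph := by
  obtain ⟨q, hq⟩ := QuerySort.Input.exists_cost_polynomial QuerySort.queryProgram
    (1000 * (Polynomial.X + 1) ^ 2)
  refine ⟨QuerySort.queryProgram, 1000 * (Polynomial.X + 1) ^ 2, q, fun n I => ?_⟩
  obtain ⟨t, c, m, hr, ht, hm⟩ := QuerySort.ensures_queryProgram I
  have hp : t ≤ (1000 * (Polynomial.X + 1) ^ 2 : Polynomial ℕ).eval n := by
    simpa only [Polynomial.eval_mul, Polynomial.eval_pow, Polynomial.eval_add, Polynomial.eval_X,
      Polynomial.eval_one, Polynomial.eval_ofNat] using ht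
  have hopt : I.IsOptimumQuerySet (QuerySort.outputSet n m) := by
    simpa using I.isOptimumQuerySet_compl hm
  exact ⟨t, c, m, hr, hp, hq n I t c m hr hp, hopt, hopt.exists_cover, I.remainingGraph_isChordal⟩
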